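/- Let $k$ be a perfect field of characteristic $2$, let $A=k[x,y,z,w]$, and let $$f=x^4+xy^3+yz^3+zw^3\in A .$$ For an integer $n\ge 1$, a ring $R$ of characteristic $p>0$ is called $n$-quasi-$F$-split if there is a homomorphism of $W_n(R)$-modules $\alpha\colon F_*W_n(R)\to R$ such that $\alpha\circ F$ is the restriction map $W_n(R)\to R$, $(a_0,\dots,a_{n-1})\mapsto a_0$, where $W_n(R)$ is the ring of $p$-typical Witt vectors of length $n$ and $F$ is its Frobenius. (1) For every integer $m$ with $1\le m\le 511$, the ring $A[t]/(f+t^m)$ is $10$-quasi-$F$-split. (2) Let $1\le m\le 511$ and $g=f+t^m$. Let $u\colon F_*(A[t])\to A[t]$ be the $A[t]$-linear map which sends $F_*(xyzwt)$ to $1$ and every other $F_*(x^{i_1}y^{i_2}z^{i_3}w^{i_4}t^{i_5})$ with all $i_j\in\{0,1\}$ to $0$; let $\Delta(g)=\sum_{i<j}M_iM_j$, where $M_1,\dots,M_5$ are the five monomials of $g$; and let $\theta(a)=u(F_*(\Delta(g)a))$. Put $$a_1=x^2yz^2w^3t^{1023-2m}\,g,\qquad a_{n+1}=\theta(a_n)\quad(n\ge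 1).$$ Then $u(F_*a_n)=0$ for $1\le n\le 9$, and $a_{10}\notin(x^2,y^2,z^2,w^2,t^2)$. Explicitly: - if $m$ is odd: $a_2=x^3y^2z^2wt^{511-m}$, $a_3=xyz^2t^{255}$, $a_4=x^2zwt^{127}$, $a_5=x^3yt^{63}$, $a_6=x^3wt^{31}$, $a_7=x^3zt^{15}$, $a_8=xz^2wt^{7}$, $a_9=x^2z^2t^{3}$, $a_{10}=xyzwt$; - if $m=2r$ with $r$ odd: $a_2=x^3y^2z^2wt^{511-m}+xy^2z^2wt^{511-r}$, $a_3=x^3yz^2t^{255-r}+xyz^2t^{255}$, $a_4=x^2zwt^{127}+zwt^{127+r}$, $a_5=x^3yt^{63}+xyt^{63+r}$, $a_6=x^3wt^{31}+xwt^{31+r}$, $a_7=x^3zt^{15}+xzt^{15+r}$, $a_8=xz^2wt^{7}$, $a_9=x^2z^2t^{3}+z^2t^{3+r}$, $a_{10}=xyzwt$; - if $m=4s$: $a_2=x^3y^2z^2wt^{511-4s}+xy^2z^2wt^{511-2s}$, $a_3=yz^2(x^3t^{255-2s}+x^2t^{255-s}+xt^{255}+t^{255+s})$, $a_4=zw(x^3t^{127-s}+x^2t^{127}+xt^{127+s}+t^{127+2s})$,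 $a_5=y(x^3t^{63}+x^2t^{63+s}+xt^{63+2s}+t^{63+3s})$, $a_6=w(x^3t^{31}+x^2t^{31+s}+xt^{31+2s}+t^{31+3s})$, $a_7=z(x^3t^{15}+x^2t^{15+s}+xt^{15+2s}+t^{15+3s})$, $a_8=xz^2wt^{7}+z^2wt^{7+s}$, $a_9=x^2z^2t^{3}+z^2t^{3+2s}$, $a_{10}=xyzwt+yzwt^{1+s}$. (3) For every integer $m\ge 256$, the ring $A[t]/(f+t^m)$ is not $9$-quasi-$F$-split. -/

import Mathlib

noncomputable section

namespace QFS

open MvPolynomial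

/-! ### Quasi-F-splitting -/

/-- The Frobenius `F : W_n(R) → W_n(R)` on `p`-typical Witt vectors of length `n` over a ring `R`
of characteristic `p`: `(a₀, …, a_{n-1}) ↦ (a₀ ^ p, …, a_{n-1} ^ p)`. -/
def truncFrob (p n : ℕ) {R : Type*} [CommRing R] (a : TruncatedWittVector p n R) :
    TruncatedWittVector p n R :=
  TruncatedWittVector.mk p fun i => a.coeff i ^ p

/-- In characteristic `p`, `truncFrob` is the map that the Witt vector Frobenius `F : W(R) → W(R)`
induces on `W_n(R)`. -/
theorem truncate_frobenius (p n : ℕ) [Fact p.Prime] {R : Type*} [CommRing R] [CharP R p]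
    (a : WittVector p R) :
    WittVector.truncate n (WittVector.frobenius a) = truncFrob p n (WittVector.truncate n a) := by
  ext i
  simp [truncFrob, WittVector.coeff_truncate, WittVector.coeff_frobenius_charP]

/-- A ring `R` of characteristic `p` is `n`-quasi-F-split (`n ≥ 1`) if there is a homomorphism of
`W_n(R)`-modules `α : F_* W_n(R) → R` with `α ∘ F = Res`, where `Res : W_n(R) → R`, `a ↦ a₀`, is the
restriction map.  Here `a ∈ W_n(R)` acts on `F_* W_n(R)` by `b ↦ F(a) * b` and on `R` through `Res`,
so `W_n(R)`-linearity of an additive map `α` says `α (F(a) * b) = a₀ * α b`. -/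
def IsQuasiFSplit (p n : ℕ) [Fact p.Prime] (R : Type*) [CommRing R] : Prop :=
  ∃ (hn : 0 < n) (α : TruncatedWittVector p n R →+ R),
    (∀ a b : TruncatedWittVector p n R, α (truncFrob p n a * b) = a.coeff ⟨0, hn⟩ * α b) ∧
    ∀ a : TruncatedWittVector p n R, α (truncFrob p n a) = a.coeff ⟨0, hn⟩

/-! ### The operators on a polynomial ring -/

/-- For `g = ∑ M_j`, a sum of monomials (with coefficients) with distinct exponents, this is
`Δ(g) = ∑ (1/p) * multinomial(p; α) * ∏ M_j ^ α_j`, summed over the `α` with `0 ≤ α_j ≤ p - 1` and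
`∑ α_j = p`.  The division by `p` is exact in `ℕ` when `p` is prime. -/
def Delta (p : ℕ) {σ k : Type*} [CommRing k] (g : MvPolynomial σ k) : MvPolynomial σ k :=
  open Classical in
  ∑ α ∈ (g.support.piAntidiag p).filter (fun α => ∀ d ∈ g.support, α d ≤ p - 1),
    ((Nat.multinomial g.support α / p : ℕ) : MvPolynomial σ k) *
      ∏ d ∈ g.support, monomial d (g.coeff d) ^ α d

/-- The generator `u : F_* B → B` of `Hom_B(F_* B, B)` for the polynomial ring `B = k[x_i]` over a
perfect field `k` of characteristic `p`: the additive map that sends `c * ∏ x_i ^ d_i` to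
`c ^ (1/p) * ∏ x_i ^ ((d_i - (p - 1)) / p)` if `d_i ≡ p - 1 (mod p)` for all `i`,
and to `0` otherwise.  (In the first case `(d_i - (p - 1)) / p` is the integer part of `d_i / p`.) -/
def u (p : ℕ) [Fact p.Prime] {σ k : Type*} [Field k] [CharP k p] [PerfectRing k p]
    (g : MvPolynomial σ k) : MvPolynomial σ k :=
  open Classical in
  ∑ d ∈ g.support.filter (fun d => ∀ i, d i % p = p - 1),
    monomial (d.mapRange (fun e => e / p) (Nat.zero_div p)) ((frobeniusEquiv k p).symm (g.coeff d))

/-- The map `θ = u(F_*(Δ(g) · -))`, in characteristic `2`. -/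
def theta {σ k : Type*} [Field k] [CharP k 2] [PerfectRing k 2]
    (g a : MvPolynomial σ k) : MvPolynomial σ k :=
  u 2 (Delta 2 g * a)

/-- The Frobenius power `𝔪^[q] = (x_i ^ q)` of the ideal `𝔪` generated by the variables. -/
def frobPow (σ k : Type*) [CommRing k] (q : ℕ) : Ideal (MvPolynomial σ k) :=
  Ideal.span (Set.range fun i : σ => (X i : MvPolynomial σ k) ^ q)

/-! ### The hypersurfaces

`A[t] = k[x, y, z, w, t]` is `MvPolynomial (Fin 5) k`, with `x, y, z, w, t` the variables
`X 0, X 1, X 2, X 3, X 4`. -/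

/-- `f = x^4 + x y^3 + y z^3 + z w^3`, as an element of `A[t] = k[x, y, z, w, t]`. -/
def f (k : Type*) [CommRing k] : MvPolynomial (Fin 5) k :=
  X 0 ^ 4 + X 0 * X 1 ^ 3 + X 1 * X 2 ^ 3 + X 2 * X 3 ^ 3

/-- `g = f + t^m`. -/
def g (k : Type*) [CommRing k] (m : ℕ) : MvPolynomial (Fin 5) k :=
  f k + X 4 ^ m

/-- The ring `A[t]/(f + t^m)`. -/
abbrev HypRing (k : Type*) [CommRing k] (m : ℕ) : Type _ :=
  MvPolynomial (Fin 5) k ⧸ Ideal.span {g k m}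

/-- The sequence `a_1 = x^2 y z^2 w^3 t^(1023 - 2m) * g`, `a_{n+1} = θ(a_n)` for `n ≥ 1`, in `A[t]`
(for `m ≤ 511`; the value at the index `0` is not used). -/
def chain (k : Type*) [Field k] [CharP k 2] [PerfectRing k 2] (m : ℕ) :
    ℕ → MvPolynomial (Fin 5) k
  | 0 => 0
  | 1 => X 0 ^ 2 * X 1 * X 2 ^ 2 * X 3 ^ 3 * X 4 ^ (1023 - 2 * m) * g k m
  | n + 2 => theta (g k m) (chain k m (n + 1))

/-- The values of `a_2, …, a_10` for odd `m`. -/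
def ChainOdd (k : Type*) [Field k] [CharP k 2] [PerfectRing k 2] (m : ℕ) : Prop :=
  let x : MvPolynomial (Fin 5) k := X 0
  let y : MvPolynomial (Fin 5) k := X 1
  let z : MvPolynomial (Fin 5) k := X 2
  let w : MvPolynomial (Fin 5) k := X 3
  let t : MvPolynomial (Fin 5) k := X 4
  chain k m 2 = x ^ 3 * y ^ 2 * z ^ 2 * w * t ^ (511 - m) ∧
  chain k m 3 = x * y * z ^ 2 * t ^ 255 ∧
  chain k m 4 = x ^ 2 * z * w * t ^ 127 ∧
  chain k m 5 = x ^ 3 * y * t ^ 63 ∧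
  chain k m 6 = x ^ 3 * w * t ^ 31 ∧
  chain k m 7 = x ^ 3 * z * t ^ 15 ∧
  chain k m 8 = x * z ^ 2 * w * t ^ 7 ∧
  chain k m 9 = x ^ 2 * z ^ 2 * t ^ 3 ∧
  chain k m 10 = x * y * z * w * t

/-- The values of `a_2, …, a_10` for `m = 2r` with `r` odd. -/
def ChainTwoModFour (k : Type*) [Field k] [CharP k 2] [PerfectRing k 2] (m r : ℕ) : Prop :=
  let x : MvPolynomial (Fin 5) k := X 0
  let y : MvPolynomial (Fin 5) k := X 1
  let z : MvPolynomial (Fin 5) k := X 2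
  let w : MvPolynomial (Fin 5) k := X 3
  let t : MvPolynomial (Fin 5) k := X 4
  chain k m 2 = x ^ 3 * y ^ 2 * z ^ 2 * w * t ^ (511 - m) +
    x * y ^ 2 * z ^ 2 * w * t ^ (511 - r) ∧
  chain k m 3 = x ^ 3 * y * z ^ 2 * t ^ (255 - r) + x * y * z ^ 2 * t ^ 255 ∧
  chain k m 4 = x ^ 2 * z * w * t ^ 127 + z * w * t ^ (127 + r) ∧
  chain k m 5 = x ^ 3 * y * t ^ 63 + x * y * t ^ (63 + r) ∧
  chain k m 6 = x ^ 3 * w * t ^ 31 + x * w * t ^ (31 + r) ∧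
  chain k m 7 = x ^ 3 * z * t ^ 15 + x * z * t ^ (15 + r) ∧
  chain k m 8 = x * z ^ 2 * w * t ^ 7 ∧
  chain k m 9 = x ^ 2 * z ^ 2 * t ^ 3 + z ^ 2 * t ^ (3 + r) ∧
  chain k m 10 = x * y * z * w * t

/-- The values of `a_2, …, a_10` for `m = 4s`. -/
def ChainZeroModFour (k : Type*) [Field k] [CharP k 2] [PerfectRing k 2] (m s : ℕ) : Prop :=
  let x : MvPolynomial (Fin 5) k := X 0
  let y : MvPolynomial (Fin 5) k := X 1
  let z : MvPolynomial (Fin 5) k := X 2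
  let w : MvPolynomial (Fin 5) k := X 3
  let t : MvPolynomial (Fin 5) k := X 4
  chain k m 2 = x ^ 3 * y ^ 2 * z ^ 2 * w * t ^ (511 - 4 * s) +
    x * y ^ 2 * z ^ 2 * w * t ^ (511 - 2 * s) ∧
  chain k m 3 = y * z ^ 2 * (x ^ 3 * t ^ (255 - 2 * s) + x ^ 2 * t ^ (255 - s) + x * t ^ 255 +
    t ^ (255 + s)) ∧
  chain k m 4 = z * w * (x ^ 3 * t ^ (127 - s) + x ^ 2 * t ^ 127 + x * t ^ (127 + s) +
    t ^ (127 + 2 * s)) ∧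
  chain k m 5 = y * (x ^ 3 * t ^ 63 + x ^ 2 * t ^ (63 + s) + x * t ^ (63 + 2 * s) +
    t ^ (63 + 3 * s)) ∧
  chain k m 6 = w * (x ^ 3 * t ^ 31 + x ^ 2 * t ^ (31 + s) + x * t ^ (31 + 2 * s) +
    t ^ (31 + 3 * s)) ∧
  chain k m 7 = z * (x ^ 3 * t ^ 15 + x ^ 2 * t ^ (15 + s) + x * t ^ (15 + 2 * s) +
    t ^ (15 + 3 * s)) ∧
  chain k m 8 = x * z ^ 2 * w * t ^ 7 + z ^ 2 * w * t ^ (7 + s) ∧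
  chain k m 9 = x ^ 2 * z ^ 2 * t ^ 3 + z ^ 2 * t ^ (3 + 2 * s) ∧
  chain k m 10 = x * y * z * w * t + y * z * w * t ^ (1 + s)

end QFS

end

/-! Write B = k[x,y,z,w,t] and R = B/(g). A splitting α kills 2 = F(V(1)), because V(1) has zeroth
component 0, so only Witt vectors modulo 2 matter. There the Frobenius is squaring
(`frobenius_sub_sq_mem`), and since k is perfect, Teichmüller representatives of monomials extend to
a ring homomorphism B → W(B)/2 (`tau`). So α is determined by its values on V^i of the lifts `wlift
c`. By duality for the free module F_*B these values are u^(i+1)(h_i c) modulo g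
(`exists_iterate_u_eq`).

The ideal (g) enters through one congruence, [g] ≡ V[Δ(g)] (`wittRel_g`), which becomes h_i g ≡
u(h_(i+1) Δ(g)) modulo g^(2^(i+1)). Dividing h_i by g^(2^(i+1)-2) and reversing the index turns this
into a recursion by θ, up to multiples of g. If it starts in (g), is exact afterwards, stays in ker
u and ends in an element with u = 1, then α can be built (`isQuasiFSplit_of_chain`); the kernel
condition makes α compatible with VF = 2. Conversely, every splitting yields such a recursion with a
multiple of g added at each step (`IsQuasiFSplit.exists_chain`), and this weaker consequence is
enough for the negative result.

Length 10 is then an explicit computation in which parities of exponents decide which monomials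
survive u. Against length 9, the coefficient of xyzwt in b_9 is traced backwards: only a few
monomials can feed it, none is divisible by a monomial of g when m ≥ 256, and so all their
coefficients vanish. -/

namespace QFS

open MvPolynomial

/-! ### Duality for F_*B: the trace u and its iterates -/

section Trace

variable {σ k : Type*} [Field k] [CharP k 2] [PerfectRing k 2]

/-- The exponent of the squarefree monomial supported on `s`. -/
noncomputable def ind [Fintype σ] [DecidableEq σ] (s : Finset σ) : σ →₀ ℕ :=
  Finsupp.equivFunOnFinite.symm fun i => if i ∈ s then 1 else 0

/-- The squarefree monomial supported on `s`. -/
noncomputable def sqfree (k : Type*) [Field k] [Fintype σ] [DecidableEq σ] (s : Finset σ) :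
    MvPolynomial σ k :=
  monomial (ind s) 1

variable [Fintype σ] [DecidableEq σ]

theorem ind_apply (s : Finset σ) (i : σ) : ind s i = if i ∈ s then 1 else 0 := rfl

/-- Halving is injective on exponents with all entries odd, so at most one term of the defining sum
reaches a given coefficient. -/
theorem coeff_u (P : MvPolynomial σ k) (d : σ →₀ ℕ) :
    (u 2 P).coeff d =
      (frobeniusEquiv k 2).symm (P.coeff (2 • d + ind Finset.univ)) := by
  classical
  simp only [u, coeff_sum, coeff_monomial]
  rw [Finset.sum_eq_single (2 • d + ind Finset.univ)]
  · rw [if_pos]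
    ext i
    simp [ind_apply]
    omega
  · intro e he hne
    rw [if_neg]
    rintro rfl
    apply hne
    ext i
    simp only [Finset.mem_filter] at he
    have := he.2 i
    simp [ind_apply]
    omega
  · intro h
    have h0 : P.coeff (2 • d + ind Finset.univ) = 0 := by
      by_contra hne
      apply h
      simp only [Finset.mem_filter, mem_support_iff]
      refine ⟨hne, fun i => ?_⟩
      simp [ind_apply]
    simp [h0]

theorem u_add (P Q : MvPolynomial σ k) : u 2 (P + Q) = u 2 P + u 2 Q := by
  ext d
  simp [coeff_u]

/-- `u` as an additive map. -/
noncomputable def uHom : MvPolynomial σ k →+ MvPolynomial σ k :=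
  AddMonoidHom.mk' (u 2) u_add

theorem u_zero : u 2 (0 : MvPolynomial σ k) = 0 := map_zero uHom

theorem u_sum {ι : Type*} (s : Finset ι) (P : ι → MvPolynomial σ k) :
    u 2 (∑ i ∈ s, P i) = ∑ i ∈ s, u 2 (P i) := map_sum uHom P s

/-- This is the B-linearity of u on F_*B. For a monomial it is a comparison of coefficients, since
2e ≤ 2d + 1 holds exactly when e ≤ d. -/
theorem u_sq_mul (c P : MvPolynomial σ k) : u 2 (c ^ 2 * P) = c * u 2 P := by
  induction c using MvPolynomial.induction_on' generalizing P with
  | add p q hp hq => rw [CharTwo.add_sq, add_mul, u_add, hp, hq, add_mul]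
  | monomial e a =>
    ext d
    rw [monomial_pow, coeff_u, coeff_monomial_mul', coeff_monomial_mul', coeff_u]
    have key : 2 • e ≤ 2 • d + ind Finset.univ ↔ e ≤ d := by
      simp only [Finsupp.le_def]
      refine forall_congr' fun i => ?_
      simp [ind_apply]
      omega
    by_cases hed : e ≤ d
    · rw [if_pos (key.2 hed), if_pos hed, map_mul]
      congr 1
      · exact (frobeniusEquiv k 2).symm_apply_apply a
      · congr 2
        ext i
        have := hed i
        simp [ind_apply]
        omega
    · rw [if_neg (mt key.1 hed), if_neg hed, map_zero]

theorem iterate_u_add (e : ℕ) (P Q : MvPolynomial σ k) :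
    (u 2)^[e] (P + Q) = (u 2)^[e] P + (u 2)^[e] Q := by
  induction e generalizing P Q with
  | zero => rfl
  | succ e ih => simp only [Function.iterate_succ_apply, u_add, ih]

theorem iterate_u_zero (e : ℕ) : (u 2)^[e] (0 : MvPolynomial σ k) = 0 :=
  Function.iterate_fixed u_zero e

theorem iterate_u_sub (e : ℕ) (P Q : MvPolynomial σ k) :
    (u 2)^[e] (P - Q) = (u 2)^[e] P - (u 2)^[e] Q := by
  have := iterate_u_add e (P - Q) Q
  rw [sub_add_cancel] at this
  rw [this, add_sub_cancel_right]

theorem iterate_u_pow_mul (e : ℕ) (c P : MvPolynomial σ k) :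
    (u 2)^[e] (c ^ 2 ^ e * P) = c * (u 2)^[e] P := by
  induction e generalizing P with
  | zero => simp
  | succ e ih => rw [Function.iterate_succ_apply, pow_succ, pow_mul, u_sq_mul, ih,
      Function.iterate_succ_apply]

/-- The squarefree monomials form a basis of F_*B, and complementary ones form the dual basis for
the pairing u(ab). The exponents of the product lie in {0, 1, 2}, so they are all odd only when they
are all 1. -/
theorem u_sqfree (s t : Finset σ) :
    u 2 (sqfree k s * sqfree k tᶜ) = if s = t then 1 else 0 := by
  have key (d : σ →₀ ℕ) : ind s + ind tᶜ = 2 • d + ind Finset.univ ↔ s = t ∧ 0 = d := by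
    constructor
    · intro h
      have h' (i : σ) := DFunLike.congr_fun h i
      simp only [Finsupp.add_apply, Finsupp.smul_apply, ind_apply, Finset.mem_compl,
        Finset.mem_univ, if_true, smul_eq_mul] at h'
      constructor
      · ext i
        have := h' i
        split_ifs at this <;> first | tauto | omega
      · ext i
        have := h' i
        simp only [Finsupp.coe_zero, Pi.zero_apply]
        split_ifs at this <;> omega
    · rintro ⟨rfl, rfl⟩
      ext i
      by_cases hi : i ∈ s <;> simp [ind_apply, hi]
  ext d
  rw [sqfree, sqfree, monomial_mul, one_mul, coeff_u, coeff_monomial]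
  by_cases h : s = t
  · by_cases hd : 0 = d
    · rw [if_pos ((key d).2 ⟨h, hd⟩), if_pos h]
      simp [hd.symm]
    · rw [if_neg (fun h' => hd ((key d).1 h').2), if_pos h, coeff_one, if_neg hd, map_zero]
  · rw [if_neg (fun h' => h ((key d).1 h').1), if_neg h, map_zero, coeff_zero]

theorem monomial_eq_sqfree_mul (d : σ →₀ ℕ) (a : k) :
    ∃ (s : Finset σ) (c : MvPolynomial σ k), monomial d a = sqfree k s * c ^ 2 := by
  classical
  refine ⟨Finset.univ.filter fun i => d i % 2 = 1,
    monomial (d.mapRange (fun e => e / 2) (Nat.zero_div 2)) ((frobeniusEquiv k 2).symm a), ?_⟩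
  rw [sqfree, monomial_pow, monomial_mul, one_mul]
  congr 1
  · congr 1
    ext i
    simp [ind_apply]
    split_ifs <;> omega
  · exact ((frobeniusEquiv k 2).apply_symm_apply a).symm

/-- A polynomial over a perfect field is a sum of products of squarefree monomials and squares. -/
theorem sqfree_induction {motive : MvPolynomial σ k → Prop}
    (hadd : ∀ P Q, motive P → motive Q → motive (P + Q))
    (hmul : ∀ s c, motive (sqfree k s * c ^ 2)) (P : MvPolynomial σ k) : motive P := by
  induction P using MvPolynomial.induction_on' with
  | add p q hp hq => exact hadd p q hp hq
  | monomial d a =>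
    obtain ⟨s, c, h⟩ := monomial_eq_sqfree_mul d a
    rw [h]
    exact hmul s c

theorem eq_sum_sqfree_mul (P : MvPolynomial σ k) :
    P = ∑ s : Finset σ, sqfree k s * u 2 (P * sqfree k sᶜ) ^ 2 := by
  induction P using sqfree_induction with
  | hadd P Q hP hQ =>
    conv_lhs => rw [hP, hQ]
    simp only [add_mul, u_add, CharTwo.add_sq, mul_add, Finset.sum_add_distrib]
  | hmul t c =>
    have (s : Finset σ) : u 2 (sqfree k t * c ^ 2 * sqfree k sᶜ) = if t = s then c else 0 := by
      rw [mul_right_comm, mul_comm, u_sq_mul, u_sqfree]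
      simp
    simp [this]

/-- The coordinates of P in the squarefree basis are values u(Pc), and they enter P squared. -/
theorem mem_span_of_u_mem {a P : MvPolynomial σ k}
    (h : ∀ c, u 2 (P * c) ∈ Ideal.span {a}) : P ∈ Ideal.span {a ^ 2} := by
  rw [eq_sum_sqfree_mul P]
  refine Ideal.sum_mem _ fun s _ => Ideal.mul_mem_left _ _ ?_
  rw [Ideal.mem_span_singleton]
  exact pow_dvd_pow_of_dvd (Ideal.mem_span_singleton.1 (h _)) 2

theorem mem_span_of_iterate_u_mem (e : ℕ) {a P : MvPolynomial σ k}
    (h : ∀ c, (u 2)^[e] (P * c) ∈ Ideal.span {a}) : P ∈ Ideal.span {a ^ 2 ^ e} := by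
  induction e generalizing P with
  | zero => simpa using h 1
  | succ e ih =>
    rw [pow_succ, pow_mul]
    refine mem_span_of_u_mem fun c => ih fun c' => ?_
    have := h (c * c' ^ 2)
    rwa [Function.iterate_succ_apply, ← mul_assoc, mul_comm _ (c' ^ 2), u_sq_mul, mul_comm] at this

/-- A `2^e`-th root linear map from a polynomial ring to its quotient is `u^e(h * -)`. -/
theorem exists_iterate_u_eq (J : Ideal (MvPolynomial σ k)) (e : ℕ)
    (φ : MvPolynomial σ k →+ MvPolynomial σ k ⧸ J)
    (hφ : ∀ r c, φ (r ^ 2 ^ e * c) = Ideal.Quotient.mk J r * φ c) :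
    ∃ h, ∀ c, φ c = Ideal.Quotient.mk J ((u 2)^[e] (h * c)) := by
  induction e generalizing φ with
  | zero =>
    obtain ⟨h, hh⟩ := Ideal.Quotient.mk_surjective (φ 1)
    refine ⟨h, fun c => ?_⟩
    have := hφ c 1
    simp only [pow_zero, pow_one, mul_one] at this
    rw [this, ← hh, Function.iterate_zero, id, mul_comm, map_mul]
  | succ e ih =>
    have hsq (s : Finset σ) (a b : MvPolynomial σ k) : sqfree k s * (a + b) ^ 2 =
        sqfree k s * a ^ 2 + sqfree k s * b ^ 2 := by rw [CharTwo.add_sq, mul_add]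
    -- Restricting φ to one coordinate line c ↦ (squarefree monomial)·c² lowers the root-linearity
    -- from 2^(e+1) to 2^e.
    choose h hh using fun s : Finset σ => ih
      (AddMonoidHom.mk' (fun c => φ (sqfree k s * c ^ 2)) fun a b => by rw [hsq, map_add])
      (fun r c => by
        simp only [AddMonoidHom.mk'_apply]
        rw [← hφ]
        congr 1
        ring)
    -- The dual basis reassembles the coordinates: u of this sum times a basis element selects a
    -- single h s.
    refine ⟨∑ s, sqfree k sᶜ * h s ^ 2, fun c => ?_⟩
    induction c using sqfree_induction with
    | hadd P Q hP hQ => rw [map_add, hP, hQ, mul_add, iterate_u_add, map_add]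
    | hmul t c =>
      have := hh t c
      simp only [AddMonoidHom.mk'_apply] at this
      rw [this, Function.iterate_succ_apply, Finset.sum_mul, u_sum]
      have key (s : Finset σ) : u 2 (sqfree k sᶜ * h s ^ 2 * (sqfree k t * c ^ 2)) =
          if t = s then h s * c else 0 := by
        have : sqfree k sᶜ * h s ^ 2 * (sqfree k t * c ^ 2) =
          (h s * c) ^ 2 * (sqfree k t * sqfree k sᶜ) := by ring
        rw [this, u_sq_mul, u_sqfree]
        simp
      simp [key]

end Trace

/-! ### Witt vectors modulo 2 -/

section WittModTwo

open WittVector (verschiebung frobenius teichmuller)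

section CharTwo

variable {A : Type*} [CommRing A]

/-- The ideal generated by `2` in the ring of Witt vectors. -/
noncomputable abbrev twoIdeal (A : Type*) [CommRing A] : Ideal (WittVector 2 A) :=
  Ideal.span {2}

theorem mem_twoIdeal {x : WittVector 2 A} : x ∈ twoIdeal A ↔ ∃ y, x = y * 2 := by
  rw [Ideal.mem_span_singleton']
  exact exists_congr fun _ => eq_comm

theorem verschiebung_two_mem {x : WittVector 2 A} (hx : x ∈ twoIdeal A) :
    verschiebung x ∈ twoIdeal A := by
  obtain ⟨y, rfl⟩ := mem_twoIdeal.1 hx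
  exact mem_twoIdeal.2 ⟨verschiebung y, by rw [mul_two, mul_two, map_add]⟩

theorem iterate_verschiebung_two_mem (i : ℕ) {x : WittVector 2 A} (hx : x ∈ twoIdeal A) :
    verschiebung^[i] x ∈ twoIdeal A := by
  induction i with
  | zero => exact hx
  | succ i ih =>
    rw [Function.iterate_succ_apply']
    exact verschiebung_two_mem ih

theorem exists_eq_verschiebung {x : WittVector 2 A} (hx : x.coeff 0 = 0) :
    ∃ y, x = verschiebung y :=
  ⟨x.shift 1, WittVector.eq_iterate_verschiebung (n := 1) fun i hi => by
    rwa [Nat.lt_one_iff.1 hi]⟩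

theorem frobenius_verschiebung_two (x : WittVector 2 A) :
    frobenius (verschiebung x) = x * 2 := by
  simpa using x.frobenius_verschiebung

theorem coeff_zero_sub (x y : WittVector 2 A) : (x - y).coeff 0 = x.coeff 0 - y.coeff 0 :=
  map_sub (WittVector.constantCoeff (p := 2)) x y

theorem verschiebung_sq (y : WittVector 2 A) :
    verschiebung y ^ 2 = verschiebung (y ^ 2) * 2 := by
  rw [sq, ← WittVector.verschiebung_mul_frobenius, frobenius_verschiebung_two, ← mul_assoc, ← sq,
    mul_two, mul_two, map_add]

variable [CharP A 2]

theorem verschiebung_frobenius_two (x : WittVector 2 A) :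
    verschiebung (frobenius x) = x * 2 := by
  simpa using x.verschiebung_frobenius

theorem coeff_zero_of_mem_twoIdeal {x : WittVector 2 A} (hx : x ∈ twoIdeal A) :
    x.coeff 0 = 0 := by
  obtain ⟨y, rfl⟩ := mem_twoIdeal.1 hx
  rw [← verschiebung_frobenius_two, WittVector.verschiebung_coeff_zero]

/-- The Witt vector Frobenius lifts the absolute Frobenius modulo `2`. -/
theorem frobenius_sub_sq_mem (x : WittVector 2 A) : frobenius x - x ^ 2 ∈ twoIdeal A := by
  -- On Teichmüller elements F is exactly squaring; on the remainder V(y), both F(V(y)) and V(y)²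
  -- are multiples of 2.
  obtain ⟨y, hy⟩ := exists_eq_verschiebung (x := x - teichmuller 2 (x.coeff 0)) (by
    rw [coeff_zero_sub, WittVector.teichmuller_coeff_zero, sub_self])
  rw [sub_eq_iff_eq_add] at hy
  generalize x.coeff 0 = a at hy
  have hF : frobenius (teichmuller 2 a) = teichmuller 2 a ^ 2 := by
    rw [WittVector.frobenius_eq_map_frobenius, WittVector.map_teichmuller, ← map_pow]
    rfl
  refine mem_twoIdeal.2 ⟨y - verschiebung (y ^ 2) - verschiebung y * teichmuller 2 a, ?_⟩
  rw [hy, map_add, hF, frobenius_verschiebung_two, add_sq, verschiebung_sq]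
  ring

theorem iterate_frobenius_sub_pow_mem (x : WittVector 2 A) (e : ℕ) :
    frobenius^[e] x - x ^ 2 ^ e ∈ twoIdeal A := by
  induction e with
  | zero => simp
  | succ e ih =>
    rw [Function.iterate_succ_apply']
    have h1 := frobenius_sub_sq_mem (frobenius^[e] x)
    have h2 := Ideal.mul_mem_right (frobenius^[e] x + x ^ 2 ^ e) _ ih
    convert Ideal.add_mem _ h1 h2 using 1
    ring

/-- If `a₀ + ⋯ + a₄ = 0` in a ring of characteristic `2`, then
`∑ [a_i] ≡ V (∑_{i < j} [a_i a_j])` modulo `2`. -/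
theorem teichmuller_sum_sub_verschiebung_mem (a : Fin 4 → A) (b : A)
    (h : a 0 + a 1 + a 2 + a 3 + b = 0) :
    let m : Fin 4 → WittVector 2 A := fun i => teichmuller 2 (a i)
    let n : WittVector 2 A := teichmuller 2 b
    (m 0 + m 1 + m 2 + m 3 + n) - verschiebung (m 0 * m 1 + m 0 * m 2 + m 0 * m 3 + m 0 * n +
      m 1 * m 2 + m 1 * m 3 + m 1 * n + m 2 * m 3 + m 2 * n + m 3 * n) ∈ twoIdeal A := by
  classical
  -- Universal case: B is a domain, so 2 can be cancelled in W(B). The result is then specialised to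
  -- A.
  let B := MvPolynomial (Fin 4) (ZMod 2)
  let c : B := -(X 0 + X 1 + X 2 + X 3)
  let M : Fin 4 → WittVector 2 B := fun i => teichmuller 2 (X i)
  let N : WittVector 2 B := teichmuller 2 c
  let E := M 0 + M 1 + M 2 + M 3 + N
  let Q := M 0 * M 1 + M 0 * M 2 + M 0 * M 3 + M 0 * N +
      M 1 * M 2 + M 1 * M 3 + M 1 * N + M 2 * M 3 + M 2 * N + M 3 * N
  have key : E - verschiebung Q ∈ twoIdeal B := by
    have hE0 : E.coeff 0 = 0 := by
      simp only [E, M, N, WittVector.add_coeff_zero, WittVector.teichmuller_coeff_zero, c]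
      ring
    obtain ⟨ε, hε⟩ := exists_eq_verschiebung hE0
    have hF (x : B) : frobenius (teichmuller 2 x) = teichmuller 2 x ^ 2 := by
      rw [WittVector.frobenius_eq_map_frobenius, WittVector.map_teichmuller, ← map_pow]
      rfl
    have h1 : frobenius E = E ^ 2 - Q * 2 := by
      simp only [E, M, N, map_add, hF, Q]
      ring
    rw [hε, frobenius_verschiebung_two, verschiebung_sq, ← sub_mul] at h1
    have h2 : (2 : WittVector 2 B) ≠ 0 := by
      simpa using WittVector.p_nonzero 2 B
    -- With E = V(ε), the identity F(E) = E² - 2Q becomes ε = V(ε²) - Q. Since ε² ≡ F(ε) and VF = 2,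
    -- this gives ε ≡ -Q modulo 2, hence E ≡ V(Q).
    have h3 := mul_right_cancel₀ h2 h1
    obtain ⟨z, hz⟩ := mem_twoIdeal.1 (frobenius_sub_sq_mem ε)
    have h4 : ε ^ 2 = frobenius ε - z * 2 := by rw [← hz]; ring
    refine mem_twoIdeal.2 ⟨verschiebung ε - verschiebung (verschiebung z) - verschiebung Q, ?_⟩
    rw [hε]
    conv_lhs => rw [h3, h4]
    rw [map_sub, map_sub, map_sub, verschiebung_frobenius_two, mul_two z, map_add, map_add,
      mul_two ε, map_add]
    ring
  let ev : B →+* A := eval₂Hom (ZMod.castHom (dvd_refl 2) A) a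
  have hX (i : Fin 4) : ev (X i) = a i := eval₂Hom_X' _ _ _
  have hb : ev c = b := by
    simp only [c, map_neg, map_add, hX]
    exact neg_eq_of_add_eq_zero_right h
  have hmap := Ideal.mem_map_of_mem (WittVector.map (p := 2) ev) key
  rw [twoIdeal, Ideal.map_span, Set.image_singleton, map_ofNat] at hmap
  simpa only [E, Q, M, N, map_sub, map_add, map_mul, WittVector.map_verschiebung,
    WittVector.map_teichmuller, hX, hb] using hmap

end CharTwo

/-! ### A multiplicative and additive lift of k[x] to W(k[x]) modulo 2 -/

section Lift

variable {σ k : Type*} [Field k] [CharP k 2] [PerfectRing k 2]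

/-- Over a perfect field F is surjective, so V(y) = V(F(z)) = 2z. Hence W(k)/2 = k, which makes the
Teichmüller map additive on constants modulo 2. -/
theorem mem_twoIdeal_of_perfect {x : WittVector 2 k} (hx : x.coeff 0 = 0) : x ∈ twoIdeal k := by
  obtain ⟨y, rfl⟩ := exists_eq_verschiebung hx
  obtain ⟨z, rfl⟩ := (WittVector.frobenius_bijective 2 k).2 y
  exact mem_twoIdeal.2 ⟨z, verschiebung_frobenius_two z⟩

/-- The ring homomorphism `k → W(k[x]) / 2` given by Teichmüller representatives. -/
noncomputable def coeffHom : k →+* WittVector 2 (MvPolynomial σ k) ⧸ twoIdeal (MvPolynomial σ k) :=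
  { ((Ideal.Quotient.mk (twoIdeal (MvPolynomial σ k))).toMonoidHom.comp
      (teichmuller 2)).comp (C : k →+* MvPolynomial σ k).toMonoidHom with
    map_zero' := by simp
    map_add' := fun a b => by
      have h : teichmuller 2 (a + b) - (teichmuller 2 a + teichmuller 2 b) ∈ twoIdeal k :=
        mem_twoIdeal_of_perfect (by
          rw [coeff_zero_sub, WittVector.add_coeff_zero]
          simp)
      have := Ideal.mem_map_of_mem (WittVector.map (p := 2) (C : k →+* MvPolynomial σ k)) h
      rw [twoIdeal, Ideal.map_span, Set.image_singleton, map_ofNat] at this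
      simp only [map_sub, map_add, WittVector.map_teichmuller] at this
      simpa using Ideal.Quotient.eq.2 this }

/-- The ring homomorphism `k[x] → W(k[x]) / 2` that sends a monomial to its Teichmüller
representative. -/
noncomputable def tau :
    MvPolynomial σ k →+* WittVector 2 (MvPolynomial σ k) ⧸ twoIdeal (MvPolynomial σ k) :=
  eval₂Hom coeffHom fun i => Ideal.Quotient.mk _ (teichmuller 2 (X i))

/-- A representative of `tau c` in `W(k[x])`. -/
noncomputable def wlift (c : MvPolynomial σ k) : WittVector 2 (MvPolynomial σ k) :=
  Quotient.out (tau c)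

theorem mk_wlift (c : MvPolynomial σ k) : Ideal.Quotient.mk _ (wlift c) = tau c :=
  Quotient.out_eq (tau c)

/-- Multiples of 2 = VF have zeroth component 0, so this component descends to W/2. Its composite
with `tau` fixes constants and variables. -/
theorem wlift_coeff_zero (c : MvPolynomial σ k) : (wlift c).coeff 0 = c := by
  let ρ : WittVector 2 (MvPolynomial σ k) ⧸ twoIdeal (MvPolynomial σ k) →+* MvPolynomial σ k :=
    Ideal.Quotient.lift _ WittVector.constantCoeff fun x hx => coeff_zero_of_mem_twoIdeal hx
  have h : ρ.comp tau = RingHom.id _ := by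
    apply MvPolynomial.ringHom_ext
    · intro r
      simp only [tau, coeffHom, RingHom.comp_apply, eval₂Hom_C]
      exact WittVector.teichmuller_coeff_zero 2 _
    · intro i
      simp only [tau, RingHom.comp_apply, eval₂Hom_X']
      exact WittVector.teichmuller_coeff_zero 2 _
  have := congrArg (· c) (congrArg DFunLike.coe h)
  simp only [RingHom.comp_apply, ← mk_wlift] at this
  exact this

theorem wlift_add (a b : MvPolynomial σ k) :
    wlift (a + b) - (wlift a + wlift b) ∈ twoIdeal (MvPolynomial σ k) := by
  rw [← Ideal.Quotient.eq, map_add]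
  simp only [mk_wlift, map_add]

theorem wlift_mul (a b : MvPolynomial σ k) :
    wlift (a * b) - wlift a * wlift b ∈ twoIdeal (MvPolynomial σ k) := by
  rw [← Ideal.Quotient.eq, map_mul]
  simp only [mk_wlift, map_mul]

theorem wlift_one : wlift 1 - 1 ∈ twoIdeal (MvPolynomial σ k) := by
  rw [← Ideal.Quotient.eq, mk_wlift, map_one, map_one]

theorem wlift_zero : wlift 0 ∈ twoIdeal (MvPolynomial σ k) := by
  rw [← Ideal.Quotient.eq_zero_iff_mem, mk_wlift, map_zero]

theorem frobenius_wlift (a : MvPolynomial σ k) (e : ℕ) :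
    frobenius^[e] (wlift a) - wlift (a ^ 2 ^ e) ∈ twoIdeal (MvPolynomial σ k) := by
  have h := iterate_frobenius_sub_pow_mem (wlift a) e
  rw [← Ideal.Quotient.eq] at h ⊢
  rw [h, map_pow, mk_wlift, mk_wlift, map_pow]

/-- `W(k[x])` is the sum of the image of `wlift` and of the image of the Verschiebung. -/
theorem exists_eq_wlift_add (b : WittVector 2 (MvPolynomial σ k)) :
    ∃ y, b = wlift (b.coeff 0) + verschiebung y := by
  obtain ⟨y, hy⟩ := exists_eq_verschiebung (x := b - wlift (b.coeff 0)) (by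
    rw [coeff_zero_sub, wlift_coeff_zero, sub_self])
  exact ⟨y, by rw [← hy]; ring⟩

end Lift

end WittModTwo

/-! ### The criterion: splittings and recursions by θ -/

section Criterion

open WittVector (verschiebung frobenius teichmuller)

variable {σ k : Type*} [Field k] [CharP k 2] [PerfectRing k 2]

/-- The Witt vector `[g] - V [D]` is, modulo `2`, congruent to one that dies in `W(k[x] / (g))`. -/
def WittRel (g D : MvPolynomial σ k) : Prop :=
  ∃ κ : WittVector 2 (MvPolynomial σ k),
    WittVector.map (Ideal.Quotient.mk (Ideal.span {g})) κ = 0 ∧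
      κ - (wlift g - verschiebung (wlift D)) ∈ twoIdeal (MvPolynomial σ k)

/-- Multiplying the relation `[g] ≡ V [D]` by `[c]` gives `[g c] ≡ V [D c²]`. -/
theorem wittRel_mul
    (c : MvPolynomial σ k) {g D : MvPolynomial σ k} {κ : WittVector 2 (MvPolynomial σ k)}
    (hκ : κ - (wlift g - verschiebung (wlift D)) ∈ twoIdeal (MvPolynomial σ k)) :
    κ * wlift c - (wlift (g * c) - verschiebung (wlift (D * c ^ 2))) ∈
      twoIdeal (MvPolynomial σ k) := by
  have h1 := Ideal.mul_mem_right (wlift c) _ hκ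
  have h2 := wlift_mul g c
  have h3 := wlift_mul D (c ^ 2)
  have h4 := Ideal.mul_mem_left _ (wlift D) (frobenius_wlift c 1)
  simp only [pow_one, Function.iterate_one] at h4
  have h5 := verschiebung_two_mem (Ideal.sub_mem _ h3 h4)
  have e : verschiebung (wlift D) * wlift c = verschiebung (wlift D * frobenius (wlift c)) :=
    (WittVector.verschiebung_mul_frobenius _ _).symm
  convert Ideal.add_mem _ (Ideal.sub_mem _ h1 h2) h5 using 1
  simp only [sub_mul, mul_sub, e, map_sub]
  ring

/-- An additive map on `W(k[x])` that is given separately on the image of `wlift` and on the image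
of the Verschiebung. -/
theorem exists_addHom_of_wlift_verschiebung {A : Type*} [AddCommGroup A]
    (φ : MvPolynomial σ k →+ A) (β : WittVector 2 (MvPolynomial σ k) →+ A)
    (hβ : ∀ y, β (frobenius y) = 0) :
    ∃ α : WittVector 2 (MvPolynomial σ k) →+ A, ∀ b c y,
      b - (wlift c + verschiebung y) ∈ twoIdeal (MvPolynomial σ k) → α b = φ c + β y := by
  choose w hw using exists_eq_wlift_add (σ := σ) (k := k)
  have key : ∀ b c y, b - (wlift c + verschiebung y) ∈ twoIdeal (MvPolynomial σ k) →
      φ (b.coeff 0) + β (w b) = φ c + β y := by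
    intro b c y h
    have h0 := coeff_zero_of_mem_twoIdeal h
    rw [coeff_zero_sub, WittVector.add_coeff_zero, wlift_coeff_zero,
      WittVector.verschiebung_coeff_zero, add_zero, sub_eq_zero] at h0
    obtain ⟨z, hz⟩ := mem_twoIdeal.1 h
    have hw' := hw b
    rw [h0] at hw' ⊢
    -- The decomposition is ambiguous by 2z = V(F(z)), which moves y by F(z); this is why β has to
    -- vanish on Frobenius images.
    have : verschiebung (w b) = verschiebung (y + frobenius z) := by
      rw [map_add, verschiebung_frobenius_two, ← hz]
      nth_rewrite 2 [hw']
      ring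
    rw [WittVector.verschiebung_injective 2 _ this, map_add, hβ, add_zero]
  refine ⟨AddMonoidHom.mk' (fun b => φ (b.coeff 0) + β (w b)) fun b b' => ?_, key⟩
  rw [key (b + b') (b.coeff 0 + b'.coeff 0) (w b + w b'), map_add, map_add]
  · abel
  · have h := wlift_add (b.coeff 0) (b'.coeff 0)
    rw [← neg_mem_iff] at h
    convert h using 1
    nth_rewrite 1 [hw b, hw b']
    rw [map_add]
    ring

variable [Fintype σ] [DecidableEq σ]

/-- The functional on `W(k[x])` that sends `∑ V^i [c_i]` to `∑ u^(e+i+1) (h_i c_i)`. -/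
theorem exists_functional {g D : MvPolynomial σ k} (hrel : WittRel g D) (n e : ℕ)
    (h : ℕ → MvPolynomial σ k) (hn : h n = 0) (hu : ∀ i, 1 ≤ i → i ≤ n → u 2 (h i) = 0)
    (hg : ∀ i < n, h i * g - u 2 (h (i + 1) * D) ∈ Ideal.span {g ^ 2 ^ (e + i + 1)}) :
    ∃ α : WittVector 2 (MvPolynomial σ k) →+ MvPolynomial σ k,
      (∀ r y, α (frobenius^[e + 1] (wlift r) * y) = r * α y) ∧
      (∀ b : WittVector 2 (MvPolynomial σ k),
        (∀ j < n, b.coeff j ∈ Ideal.span {g}) → α b ∈ Ideal.span {g}) ∧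
      (∀ b c, b - wlift c ∈ twoIdeal (MvPolynomial σ k) → α b = (u 2)^[e + 1] (h 0 * c)) ∧
      (u 2 (h 0) = 0 → ∀ y, α (frobenius y) = 0) := by
  induction n generalizing e h with
  | zero =>
    refine ⟨0, by simp, by simp, fun b c _ => ?_, by simp⟩
    rw [hn, zero_mul, iterate_u_zero, AddMonoidHom.zero_apply]
  | succ n ih =>
    -- β is the functional on the Verschiebung part: one V shifts the sequence h and costs one more
    -- u.
    obtain ⟨β, hβ1, hβ2, hβ3, hβ4⟩ := ih (e + 1) (fun i => h (i + 1)) hn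
      (fun i _ hi => hu (i + 1) (by omega) (by omega))
      (fun i hi => by
        have := hg (i + 1) (by omega)
        rwa [show e + (i + 1) + 1 = e + 1 + i + 1 by omega] at this)
    let φ : MvPolynomial σ k →+ MvPolynomial σ k :=
      AddMonoidHom.mk' (fun c => (u 2)^[e + 1] (h 0 * c)) fun a b => by
        rw [mul_add, iterate_u_add]
    obtain ⟨α, hα⟩ := exists_addHom_of_wlift_verschiebung φ β
      (hβ4 (hu 1 le_rfl (by omega)))
    have hα0 (b c) (hb : b - wlift c ∈ twoIdeal (MvPolynomial σ k)) :
        α b = (u 2)^[e + 1] (h 0 * c) := by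
      rw [hα b c 0 (by simpa using hb), map_zero, add_zero]
      rfl
    have hαV (y) : α (verschiebung y) = β y := by
      rw [hα _ 0 y, map_zero, zero_add]
      rw [sub_add_cancel_right]
      exact neg_mem wlift_zero
    refine ⟨α, fun r y => ?_, fun b hb => ?_, hα0, fun h0 y => ?_⟩
    · obtain ⟨y', hy⟩ := exists_eq_wlift_add y
      generalize y.coeff 0 = c at hy
      have e1 := hα y c y' (by rw [hy, sub_self]; exact zero_mem _)
      have e2 := hα (frobenius^[e + 1] (wlift r) * y) (r ^ 2 ^ (e + 1) * c)
        (frobenius^[e + 1 + 1] (wlift r) * y') (by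
          have h1 := Ideal.mul_mem_right (wlift c) _ (frobenius_wlift r (e + 1))
          have h2 := wlift_mul (r ^ 2 ^ (e + 1)) c
          convert Ideal.sub_mem _ h1 h2 using 1
          rw [hy, Function.iterate_succ_apply' _ (e + 1), mul_comm (WittVector.frobenius _) y',
            WittVector.verschiebung_mul_frobenius]
          ring)
      rw [e2, e1, hβ1, mul_add]
      congr 1
      change (u 2)^[e + 1] _ = r * (u 2)^[e + 1] _
      rw [← iterate_u_pow_mul]
      congr 1
      ring
    -- Subtracting a multiple of κ clears the zeroth component without changing the image over
    -- B/(g); the rest is V(b') with the components of b' still in (g). On the multiple of κ, α is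
    -- u^(e+1) of (h_0 g - u(h_1 D))c, which lies in (g) by `hg`.
    · obtain ⟨κ, hκ, hκ2⟩ := hrel
      obtain ⟨c, hc⟩ := Ideal.mem_span_singleton.1 (hb 0 (by omega))
      have hmul := wittRel_mul c hκ2
      have h0 : (κ * wlift c).coeff 0 = g * c := by
        have := coeff_zero_of_mem_twoIdeal hmul
        rwa [coeff_zero_sub, coeff_zero_sub, WittVector.verschiebung_coeff_zero, sub_zero,
          wlift_coeff_zero, sub_eq_zero] at this
      obtain ⟨b', hb'⟩ := exists_eq_verschiebung (x := b - κ * wlift c) (by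
        rw [coeff_zero_sub, h0, hc, sub_self])
      have hbeq : b = κ * wlift c + verschiebung b' := by rw [← hb']; ring
      have h1 : α (κ * wlift c) ∈ Ideal.span {g} := by
        rw [hα (κ * wlift c) (g * c) (-wlift (D * c ^ 2)) (by
          rw [map_neg, ← sub_eq_add_neg]
          exact hmul), map_neg, hβ3 _ (D * c ^ 2) (by rw [sub_self]; exact zero_mem _)]
        change (u 2)^[e + 1] _ + _ ∈ _
        rw [Function.iterate_succ_apply _ (e + 1), zero_add,
          show h 1 * (D * c ^ 2) = c ^ 2 * (h 1 * D) by ring, u_sq_mul, ← sub_eq_add_neg,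
          ← iterate_u_sub]
        obtain ⟨q, hq⟩ := Ideal.mem_span_singleton.1 (hg 0 (by omega))
        rw [show h 0 * (g * c) - c * u 2 (h 1 * D) = g ^ 2 ^ (e + 1) * (q * c) by
          simp only [zero_add, add_zero] at hq
          linear_combination c * hq, iterate_u_pow_mul]
        exact Ideal.mul_mem_right _ _ (Ideal.mem_span_singleton_self g)
      rw [hbeq, map_add, hαV]
      refine Ideal.add_mem _ h1 (hβ2 b' fun j hj => ?_)
      have h2 := congrArg (fun x => (WittVector.map (Ideal.Quotient.mk (Ideal.span {g})) x).coeff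
        (j + 1)) hbeq
      simp only [map_add, map_mul, hκ, zero_mul, zero_add, WittVector.map_coeff,
        WittVector.verschiebung_coeff_succ] at h2
      rw [← Ideal.Quotient.eq_zero_iff_mem, ← h2, Ideal.Quotient.eq_zero_iff_mem]
      exact hb (j + 1) (by omega)
    · obtain ⟨y', hy⟩ := exists_eq_wlift_add y
      rw [hα0 _ (y.coeff 0 ^ 2) _, Function.iterate_succ_apply, mul_comm, u_sq_mul, h0, mul_zero,
        iterate_u_zero]
      have h1 := frobenius_wlift (y.coeff 0) 1
      simp only [pow_one, Function.iterate_one] at h1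
      nth_rewrite 1 [hy]
      rw [map_add, frobenius_verschiebung_two, add_sub_right_comm]
      exact Ideal.add_mem _ h1 (mem_twoIdeal.2 ⟨y', rfl⟩)

/-- A sequence `a_1 ∈ (g)`, `a_{j+1} = u (D a_j)` in `ker u` whose last term is a splitting of `u`
makes `k[x] / (g)` quasi-F-split. -/
theorem isQuasiFSplit_of_chain {g D : MvPolynomial σ k} (hrel : WittRel g D) (n : ℕ)
    (a : ℕ → MvPolynomial σ k) (h1 : a 1 ∈ Ideal.span {g})
    (hstep : ∀ j, 1 ≤ j → j ≤ n → a (j + 1) = u 2 (D * a j))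
    (hker : ∀ j, 1 ≤ j → j ≤ n → u 2 (a j) = 0) (hlast : u 2 (a (n + 1)) = 1) :
    IsQuasiFSplit 2 (n + 1) (MvPolynomial σ k ⧸ Ideal.span {g}) := by
  -- The even power of g leaves u as g^(2^i - 1), so the relations for i < n hold exactly. At i = n
  -- there is no next term, and the missing factor g comes from a_1 ∈ (g).
  let h : ℕ → MvPolynomial σ k := fun i =>
    if i ≤ n then g ^ (2 ^ (i + 1) - 2) * a (n + 1 - i) else 0
  have hpow (i : ℕ) : g ^ (2 ^ (i + 1) - 2) = (g ^ (2 ^ i - 1)) ^ 2 := by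
    rw [← pow_mul]
    congr 1
    rw [pow_succ]
    omega
  obtain ⟨α, hα1, hα2, hα3, -⟩ := exists_functional hrel (n + 1) 0 h (by simp [h])
    (fun i hi hi' => by
      by_cases hin : i ≤ n
      · simp only [h, if_pos hin, hpow]
        rw [u_sq_mul, hker _ (by omega) (by omega), mul_zero]
      · simp only [h, if_neg hin, u_zero])
    (fun i hi => by
      rw [zero_add]
      have hp : 2 ≤ 2 ^ (i + 1) := Nat.le_self_pow (by omega) 2
      by_cases hin : i + 1 ≤ n
      · have : h i * g - u 2 (h (i + 1) * D) = 0 := by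
          simp only [h, if_pos hin, if_pos (by omega : i ≤ n), hpow (i + 1)]
          rw [mul_assoc ((g ^ _) ^ 2), u_sq_mul, show n + 1 - i = (n + 1 - (i + 1)) + 1 by omega,
            hstep _ (by omega) (by omega), mul_comm D,
            show 2 ^ (i + 1) - 1 = 2 ^ (i + 1) - 2 + 1 by omega, pow_succ]
          ring
        rw [this]
        exact zero_mem _
      · obtain rfl : i = n := by omega
        obtain ⟨c, hc⟩ := Ideal.mem_span_singleton.1 h1
        simp only [h, if_neg hin, if_pos le_rfl, zero_mul, u_zero, sub_zero,
          Nat.add_sub_cancel_left, hc]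
        rw [Ideal.mem_span_singleton]
        refine ⟨c, ?_⟩
        rw [show 2 ^ (i + 1) = 2 ^ (i + 1) - 2 + 1 + 1 by omega, pow_succ, pow_succ]
        simp only [Nat.add_sub_cancel, Nat.add_assoc, Nat.reduceAdd]
        ring)
  set R := MvPolynomial σ k ⧸ Ideal.span {g}
  let π : WittVector 2 (MvPolynomial σ k) →+* TruncatedWittVector 2 (n + 1) R :=
    (WittVector.truncate (n + 1)).comp (WittVector.map (Ideal.Quotient.mk (Ideal.span {g})))
  have hπs : Function.Surjective π :=
    (WittVector.truncate_surjective 2 (n + 1) R).comp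
      (WittVector.map_surjective _ Ideal.Quotient.mk_surjective)
  have hπc (x) (i : Fin (n + 1)) : (π x).coeff i = Ideal.Quotient.mk _ (x.coeff i) := by
    simp [π, WittVector.coeff_truncate, WittVector.map_coeff]
  have hπF (x) : truncFrob 2 (n + 1) (π x) = π (frobenius x) := by
    ext i
    rw [truncFrob, TruncatedWittVector.coeff_mk, hπc, hπc, WittVector.coeff_frobenius_charP,
      map_pow]
  let γ : WittVector 2 (MvPolynomial σ k) →+ R :=
    (Ideal.Quotient.mk (Ideal.span {g})).toAddMonoidHom.comp α
  have hγ : π.toAddMonoidHom.ker ≤ γ.ker := by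
    intro x hx
    rw [AddMonoidHom.mem_ker] at hx ⊢
    refine Ideal.Quotient.eq_zero_iff_mem.2 (hα2 x fun j hj => ?_)
    rw [← Ideal.Quotient.eq_zero_iff_mem, ← hπc x ⟨j, hj⟩]
    have : π x = 0 := hx
    rw [this, TruncatedWittVector.coeff_zero]
  have hα2' (x : WittVector 2 (MvPolynomial σ k)) : α (x * 2) = 0 := by
    rw [hα3 _ 0, mul_zero, iterate_u_zero]
    exact Ideal.sub_mem _ (mem_twoIdeal.2 ⟨x, rfl⟩) wlift_zero
  -- Linearity is known only for lifts; the error F(V(z)) = 2z is killed by α.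
  have hαF (x y : WittVector 2 (MvPolynomial σ k)) :
      α (frobenius x * y) = x.coeff 0 * α y := by
    obtain ⟨z, hz⟩ := exists_eq_wlift_add x
    nth_rewrite 1 [hz]
    rw [map_add, frobenius_verschiebung_two, add_mul, map_add, mul_right_comm, hα2', add_zero]
    exact hα1 _ _
  have hα1' : α 1 = 1 := by
    rw [hα3 1 1 (by rw [← neg_mem_iff, neg_sub]; exact wlift_one), mul_one]
    simpa [h] using hlast
  let γ' := π.toAddMonoidHom.liftOfSurjective hπs ⟨γ, hγ⟩
  have hγ' (x) : γ' (π x) = γ x :=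
    AddMonoidHom.liftOfRightInverse_comp_apply _ _ _ ⟨γ, hγ⟩ x
  have hmul (a b : TruncatedWittVector 2 (n + 1) R) :
      γ' (truncFrob 2 (n + 1) a * b) = a.coeff ⟨0, n.succ_pos⟩ * γ' b := by
    obtain ⟨a, rfl⟩ := hπs a
    obtain ⟨b, rfl⟩ := hπs b
    rw [hπF, ← map_mul, hγ', hγ', hπc]
    change Ideal.Quotient.mk _ (α _) = _ * Ideal.Quotient.mk _ (α b)
    rw [hαF, map_mul]
  refine ⟨n.succ_pos, γ', hmul, fun a => ?_⟩
  have := hmul a 1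
  rw [mul_one] at this
  rw [this, ← map_one π, hγ']
  change _ * Ideal.Quotient.mk _ (α 1) = _
  rw [hα1', map_one, mul_one]

/-- If `k[x] / (g)` is `n`-quasi-F-split, there is a sequence `b_0 = 0`,
`b_{j+1} = u (D b_j) + g c_j` with `u (b_n) = 1` modulo `g`. -/
theorem IsQuasiFSplit.exists_chain {g D : MvPolynomial σ k} (hrel : WittRel g D) (hg0 : g ≠ 0)
    {n : ℕ} (hsplit : IsQuasiFSplit 2 n (MvPolynomial σ k ⧸ Ideal.span {g})) :
    ∃ b c : ℕ → MvPolynomial σ k, b 0 = 0 ∧ (∀ j, b (j + 1) = u 2 (D * b j) + g * c j) ∧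
      u 2 (b n) - 1 ∈ Ideal.span {g} := by
  obtain ⟨hn, α, hα1, hα2⟩ := hsplit
  set R := MvPolynomial σ k ⧸ Ideal.span {g}
  let π : WittVector 2 (MvPolynomial σ k) →+* TruncatedWittVector 2 n R :=
    (WittVector.truncate n).comp (WittVector.map (Ideal.Quotient.mk (Ideal.span {g})))
  have hπc (x) (i : Fin n) : (π x).coeff i = Ideal.Quotient.mk _ (x.coeff i) := by
    simp [π, WittVector.coeff_truncate, WittVector.map_coeff]
  have hπF (x) : truncFrob 2 n (π x) = π (frobenius x) := by
    ext i
    rw [truncFrob, TruncatedWittVector.coeff_mk, hπc, hπc, WittVector.coeff_frobenius_charP,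
      map_pow]
  let ψ : WittVector 2 (MvPolynomial σ k) →+ R := α.comp π.toAddMonoidHom
  have hψ (x) : ψ x = α (π x) := rfl
  have hψF (x y) : ψ (frobenius x * y) = Ideal.Quotient.mk _ (x.coeff 0) * ψ y := by
    rw [hψ, map_mul, ← hπF, hα1, hπc, hψ]
  have hψ1 : ψ 1 = 1 := by
    have h1 : π 1 = truncFrob 2 n (π 1) := by
      rw [hπF]
      exact congrArg π (map_one WittVector.frobenius).symm
    rw [hψ, h1, hα2, hπc, WittVector.one_coeff_zero, map_one]
  -- Here 2z = F(V(1))z, and V(1) acts on the target through its zeroth component 0.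
  have hψ2 {x y} (h : x - y ∈ twoIdeal (MvPolynomial σ k)) : ψ x = ψ y := by
    rw [← sub_eq_zero, ← map_sub]
    obtain ⟨z, hz⟩ := mem_twoIdeal.1 h
    rw [hz, ← one_mul z, mul_right_comm, ← frobenius_verschiebung_two, hψF,
      WittVector.verschiebung_coeff_zero, map_zero, zero_mul]
  have hψn (x) : ψ (verschiebung^[n] x) = 0 := by
    have : π (verschiebung^[n] x) = 0 := by
      ext i
      rw [hπc, WittVector.iterate_verschiebung_coeff_eq_zero _ i.2, map_zero,
        TruncatedWittVector.coeff_zero]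
    rw [hψ, this, map_zero]
  have hVsub (i : ℕ) (x y : WittVector 2 (MvPolynomial σ k)) :
      verschiebung^[i] (x - y) = verschiebung^[i] x - verschiebung^[i] y :=
    iterate_map_sub _ i x y
  have hVadd (i : ℕ) (x y : WittVector 2 (MvPolynomial σ k)) :
      verschiebung^[i] (x + y) = verschiebung^[i] x + verschiebung^[i] y :=
    iterate_map_add _ i x y
  have hψV (i : ℕ) {x y} (h : x - y ∈ twoIdeal (MvPolynomial σ k)) :
      ψ (verschiebung^[i] x) = ψ (verschiebung^[i] y) :=
    hψ2 (by rw [← hVsub]; exact iterate_verschiebung_two_mem i h)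
  let φ (i : ℕ) : MvPolynomial σ k →+ R :=
    AddMonoidHom.mk' (fun c => ψ (verschiebung^[i] (wlift c))) fun a b => by
      rw [hψV i (wlift_add a b), hVadd, map_add]
  have hφ (i : ℕ) (c) : φ i c = ψ (verschiebung^[i] (wlift c)) := rfl
  have hφlin (i : ℕ) (r c) : φ i (r ^ 2 ^ (i + 1) * c) = Ideal.Quotient.mk _ r * φ i c := by
    have h1 : wlift (r ^ 2 ^ (i + 1) * c) - wlift c * frobenius^[i] (frobenius (wlift r)) ∈
        twoIdeal (MvPolynomial σ k) := by
      have h1 := wlift_mul (r ^ 2 ^ (i + 1)) c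
      have h2 := Ideal.mul_mem_right (wlift c) _ (frobenius_wlift r (i + 1))
      rw [Function.iterate_succ_apply] at h2
      convert Ideal.sub_mem _ h1 h2 using 1
      ring
    rw [hφ, hψV i h1, ← WittVector.iterate_verschiebung_mul_left, mul_comm, hψF,
      wlift_coeff_zero, hφ]
  have hφrel (i : ℕ) (c) : φ i (g * c) = φ (i + 1) (D * c ^ 2) := by
    obtain ⟨κ, hκ, hκ2⟩ := hrel
    have h1 := wittRel_mul c hκ2
    have h2 : ψ (verschiebung^[i] (κ * wlift c)) = 0 := by
      have : WittVector.map (Ideal.Quotient.mk (Ideal.span {g}))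
          (verschiebung^[i] (κ * wlift c)) = 0 := by
        have h3 : WittVector.map (Ideal.Quotient.mk (Ideal.span {g})) (κ * wlift c) = 0 := by
          rw [map_mul, hκ, zero_mul]
        rw [WittVector.map_eq_zero_iff] at h3 ⊢
        intro m
        by_cases hm : m < i
        · rw [WittVector.iterate_verschiebung_coeff_eq_zero _ hm, map_zero]
        · obtain ⟨m, rfl⟩ := Nat.exists_eq_add_of_le' (not_lt.1 hm)
          rw [WittVector.iterate_verschiebung_coeff, h3]
      rw [hψ, RingHom.comp_apply, this, map_zero, map_zero]
    rw [hψV i h1, hVsub, map_sub, sub_eq_zero] at h2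
    rw [hφ, h2, hφ, Function.iterate_succ_apply]
  choose h hh using fun i => exists_iterate_u_eq (Ideal.span {g}) (i + 1) (φ i) (hφlin i)
  -- The multiplier h n represents the zero map only modulo g; replacing it by an honest 0 starts
  -- the recursion at b_0 = 0.
  let h' : ℕ → MvPolynomial σ k := fun i => if i < n then h i else 0
  have hh' (i : ℕ) (hi : i ≤ n) (c) :
      φ i c = Ideal.Quotient.mk (Ideal.span {g}) ((u 2)^[i + 1] (h' i * c)) := by
    rcases hi.lt_or_eq with hi | rfl
    · simp only [h', if_pos hi, hh]
    · simp only [h', lt_irrefl, if_false, zero_mul, iterate_u_zero, map_zero, hφ, hψn]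
  -- The relation between φ i and φ (i + 1), tested against every c, lifts from a congruence modulo
  -- g to one modulo g^(2^(i+1)).
  have hdvd (i : ℕ) (hi : i < n) :
      ∃ c, h' i * g - u 2 (h' (i + 1) * D) = g ^ 2 ^ (i + 1) * c := by
    rw [← dvd_def, ← Ideal.mem_span_singleton]
    refine mem_span_of_iterate_u_mem (i + 1) fun c => ?_
    have h1 := hφrel i c
    rw [hh' i hi.le, hh' (i + 1) hi, Ideal.Quotient.eq, Function.iterate_succ_apply _ (i + 1),
      show h' (i + 1) * (D * c ^ 2) = c ^ 2 * (h' (i + 1) * D) by ring, u_sq_mul,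
      ← iterate_u_sub] at h1
    convert h1 using 2
    ring
  choose! c hc using hdvd
  let b : ℕ → MvPolynomial σ k := fun j =>
    Nat.rec 0 (fun j x => u 2 (D * x) + g * c (n - 1 - j)) j
  have hb (j : ℕ) : b (j + 1) = u 2 (D * b j) + g * c (n - 1 - j) := rfl
  have hhb (j : ℕ) (hj : j ≤ n) : h' (n - j) = g ^ (2 ^ (n - j + 1) - 2) * b j := by
    induction j with
    | zero => simp [h', b]
    | succ j ih =>
      have h1 := hc (n - (j + 1)) (by omega)
      have h2 := ih (by omega)
      rw [show n - (j + 1) + 1 = n - j by omega] at h1 ⊢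
      have hpow : g ^ (2 ^ (n - j + 1) - 2) = (g ^ (2 ^ (n - j) - 1)) ^ 2 := by
        rw [← pow_mul]
        congr 1
        rw [pow_succ]
        omega
      have hp : 2 ≤ 2 ^ (n - j) := Nat.le_self_pow (by omega) 2
      obtain ⟨q, hq⟩ := Nat.exists_eq_add_of_le' hp
      rw [h2, hpow, mul_assoc, u_sq_mul, hq, sub_eq_iff_eq_add] at h1
      apply mul_right_cancel₀ hg0
      rw [h1, hb, hq, show n - 1 - j = n - (j + 1) by omega, mul_comm (b j),
        show q + 2 - 1 = q + 1 by omega, Nat.add_sub_cancel]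
      ring
  refine ⟨b, fun j => c (n - 1 - j), rfl, hb, ?_⟩
  have h0 := hh' 0 n.zero_le 1
  have hb0 := hhb n le_rfl
  rw [Nat.sub_self] at hb0
  rw [hφ, Function.iterate_zero, id, hψ2 wlift_one, hψ1, hb0] at h0
  simp only [zero_add, pow_one, Nat.sub_self, pow_zero, one_mul, mul_one,
    Function.iterate_one] at h0
  exact Ideal.Quotient.eq.1 h0.symm

end Criterion

/-! ### Monomials in five variables and the Witt vector relation for g -/

section Monomials

variable (k : Type*) [Field k]

/-- The exponent vector `(a, b, c, d, e)`. -/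
noncomputable def exps (a b c d e : ℕ) : Fin 5 →₀ ℕ :=
  Finsupp.equivFunOnFinite.symm ![a, b, c, d, e]

/-- The monomial `x^a y^b z^c w^d t^e`. -/
noncomputable def mon (a b c d e : ℕ) : MvPolynomial (Fin 5) k :=
  monomial (exps a b c d e) 1

theorem forall_fin_five {p : Fin 5 → Prop} : (∀ i, p i) ↔ p 0 ∧ p 1 ∧ p 2 ∧ p 3 ∧ p 4 := by
  simp [Fin.forall_fin_succ]

theorem exps_inj {a b c d e a' b' c' d' e' : ℕ} : exps a b c d e = exps a' b' c' d' e' ↔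
    a = a' ∧ b = b' ∧ c = c' ∧ d = d' ∧ e = e' := by
  rw [DFunLike.ext_iff, forall_fin_five]
  rfl

theorem exps_le {a b c d e a' b' c' d' e' : ℕ} : exps a b c d e ≤ exps a' b' c' d' e' ↔
    a ≤ a' ∧ b ≤ b' ∧ c ≤ c' ∧ d ≤ d' ∧ e ≤ e' := by
  rw [Finsupp.le_def, forall_fin_five]
  rfl

theorem exps_add (a b c d e a' b' c' d' e' : ℕ) : exps a b c d e + exps a' b' c' d' e' =
    exps (a + a') (b + b') (c + c') (d + d') (e + e') := by
  rw [DFunLike.ext_iff, forall_fin_five]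
  exact ⟨rfl, rfl, rfl, rfl, rfl⟩

theorem exps_sub (a b c d e a' b' c' d' e' : ℕ) : exps a b c d e - exps a' b' c' d' e' =
    exps (a - a') (b - b') (c - c') (d - d') (e - e') := by
  rw [DFunLike.ext_iff, forall_fin_five]
  exact ⟨rfl, rfl, rfl, rfl, rfl⟩

theorem two_smul_exps_add_ind (a b c d e : ℕ) : 2 • exps a b c d e + ind Finset.univ =
    exps (2 * a + 1) (2 * b + 1) (2 * c + 1) (2 * d + 1) (2 * e + 1) := by
  rw [DFunLike.ext_iff, forall_fin_five]
  exact ⟨rfl, rfl, rfl, rfl, rfl⟩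

theorem mon_eq (a b c d e : ℕ) :
    mon k a b c d e = X 0 ^ a * X 1 ^ b * X 2 ^ c * X 3 ^ d * X 4 ^ e := by
  rw [mon, monomial_eq, map_one, one_mul, Finsupp.prod_fintype _ _ (fun i => pow_zero _),
    Fin.prod_univ_five]
  rfl

theorem mon_mul (a b c d e a' b' c' d' e' : ℕ) :
    mon k a b c d e * mon k a' b' c' d' e' = mon k (a + a') (b + b') (c + c') (d + d') (e + e') := by
  rw [mon, mon, monomial_mul, exps_add, one_mul, mon]

theorem mon_congr {a b c d e e' : ℕ} (h : e = e') : mon k a b c d e = mon k a b c d e' := by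
  rw [h]

theorem coeff_mon_mul (a b c d e a' b' c' d' e' : ℕ) (P : MvPolynomial (Fin 5) k) :
    (mon k a b c d e * P).coeff (exps a' b' c' d' e') =
      if a ≤ a' ∧ b ≤ b' ∧ c ≤ c' ∧ d ≤ d' ∧ e ≤ e' then
        P.coeff (exps (a' - a) (b' - b) (c' - c) (d' - d) (e' - e)) else 0 := by
  rw [mon, coeff_monomial_mul']
  simp only [exps_le, exps_sub, one_mul]

theorem g_eq (m : ℕ) : g k m = mon k 4 0 0 0 0 + mon k 1 3 0 0 0 + mon k 0 1 3 0 0 +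
    mon k 0 0 1 3 0 + mon k 0 0 0 0 m := by
  simp only [g, f, mon_eq]
  ring

/-- The sum of the products of two distinct monomials of `g`. -/
noncomputable def pairSum (m : ℕ) : MvPolynomial (Fin 5) k :=
  mon k 5 3 0 0 0 + mon k 4 1 3 0 0 + mon k 4 0 1 3 0 + mon k 4 0 0 0 m + mon k 1 4 3 0 0 +
    mon k 1 3 1 3 0 + mon k 1 3 0 0 m + mon k 0 1 4 3 0 + mon k 0 1 3 0 m + mon k 0 0 1 3 m

variable [CharP k 2] [PerfectRing k 2]

theorem u_mon (a b c d e : ℕ) : u 2 (mon k a b c d e) =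
    if a % 2 = 1 ∧ b % 2 = 1 ∧ c % 2 = 1 ∧ d % 2 = 1 ∧ e % 2 = 1 then
      mon k (a / 2) (b / 2) (c / 2) (d / 2) (e / 2) else 0 := by
  have key (v : Fin 5 →₀ ℕ) : exps a b c d e = 2 • v + ind Finset.univ ↔
      (a % 2 = 1 ∧ b % 2 = 1 ∧ c % 2 = 1 ∧ d % 2 = 1 ∧ e % 2 = 1) ∧
        exps (a / 2) (b / 2) (c / 2) (d / 2) (e / 2) = v := by
    rw [DFunLike.ext_iff (f := exps a b c d e), DFunLike.ext_iff (f := exps (a / 2) _ _ _ _),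
      forall_fin_five, forall_fin_five]
    change a = 2 * v 0 + 1 ∧ b = 2 * v 1 + 1 ∧ c = 2 * v 2 + 1 ∧ d = 2 * v 3 + 1 ∧
      e = 2 * v 4 + 1 ↔ _ ∧ a / 2 = v 0 ∧ b / 2 = v 1 ∧ c / 2 = v 2 ∧ d / 2 = v 3 ∧ e / 2 = v 4
    omega
  ext v
  rw [coeff_u, mon, coeff_monomial]
  simp only [key]
  split_ifs with h1 h2 h2
  · rw [mon, coeff_monomial, if_pos h1.2, map_one]
  · exact absurd h1.1 h2
  · rw [mon, coeff_monomial, if_neg (fun h => h1 ⟨h2, h⟩), map_zero]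
  · rw [map_zero, coeff_zero]

theorem u_mon_odd {a b c d e : ℕ} (ha : a % 2 = 1) (hb : b % 2 = 1) (hc : c % 2 = 1)
    (hd : d % 2 = 1) (he : e % 2 = 1) :
    u 2 (mon k a b c d e) = mon k (a / 2) (b / 2) (c / 2) (d / 2) (e / 2) := by
  rw [u_mon, if_pos ⟨ha, hb, hc, hd, he⟩]

theorem u_mon_even {a b c d e : ℕ}
    (h : a % 2 = 0 ∨ b % 2 = 0 ∨ c % 2 = 0 ∨ d % 2 = 0 ∨ e % 2 = 0) :
    u 2 (mon k a b c d e) = 0 := by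
  rw [u_mon, if_neg (by omega)]

theorem tau_mon (a b c d e : ℕ) :
    tau (mon k a b c d e) = Ideal.Quotient.mk _ (WittVector.teichmuller 2 (mon k a b c d e)) := by
  have (i : Fin 5) : tau (X i : MvPolynomial (Fin 5) k) =
      Ideal.Quotient.mk _ (WittVector.teichmuller 2 (X i)) := eval₂Hom_X' _ _ _
  simp only [mon_eq, map_mul, map_pow, this]

/-- The Teichmüller congruence needs five terms with sum 0, while the monomials of g sum to g. It is
applied with the last monomial N replaced by N - g, which has the same image modulo g. -/
theorem wittRel_g (m : ℕ) : WittRel (g k m) (pairSum k m) := by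
  let M : Fin 4 → MvPolynomial (Fin 5) k :=
    ![mon k 4 0 0 0 0, mon k 1 3 0 0 0, mon k 0 1 3 0 0, mon k 0 0 1 3 0]
  let N := mon k 0 0 0 0 m
  let T (N : MvPolynomial (Fin 5) k) : WittVector 2 (MvPolynomial (Fin 5) k) :=
    (WittVector.teichmuller 2 (M 0) + WittVector.teichmuller 2 (M 1) +
      WittVector.teichmuller 2 (M 2) + WittVector.teichmuller 2 (M 3) +
      WittVector.teichmuller 2 N)
  let Q (N : MvPolynomial (Fin 5) k) : WittVector 2 (MvPolynomial (Fin 5) k) :=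
    WittVector.teichmuller 2 (M 0) * WittVector.teichmuller 2 (M 1) +
    WittVector.teichmuller 2 (M 0) * WittVector.teichmuller 2 (M 2) +
    WittVector.teichmuller 2 (M 0) * WittVector.teichmuller 2 (M 3) +
    WittVector.teichmuller 2 (M 0) * WittVector.teichmuller 2 N +
    WittVector.teichmuller 2 (M 1) * WittVector.teichmuller 2 (M 2) +
    WittVector.teichmuller 2 (M 1) * WittVector.teichmuller 2 (M 3) +
    WittVector.teichmuller 2 (M 1) * WittVector.teichmuller 2 N +
    WittVector.teichmuller 2 (M 2) * WittVector.teichmuller 2 (M 3) +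
    WittVector.teichmuller 2 (M 2) * WittVector.teichmuller 2 N +
    WittVector.teichmuller 2 (M 3) * WittVector.teichmuller 2 N
  have hg : g k m = M 0 + M 1 + M 2 + M 3 + N := g_eq k m
  have hN : Ideal.Quotient.mk (Ideal.span {g k m}) (N - g k m) = Ideal.Quotient.mk _ N := by
    rw [Ideal.Quotient.eq, sub_sub_cancel_left, neg_mem_iff]
    exact Ideal.mem_span_singleton_self _
  obtain ⟨y, hy⟩ := mem_twoIdeal.1 (teichmuller_sum_sub_verschiebung_mem M (N - g k m)
    (by rw [hg]; ring))
  refine ⟨T N - WittVector.verschiebung (Q N) - y * 2, ?_, ?_⟩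
  · have hy' := congrArg (WittVector.map (Ideal.Quotient.mk (Ideal.span {g k m}))) hy
    simp only [map_sub, map_add, map_mul, WittVector.map_verschiebung, WittVector.map_teichmuller,
      hN] at hy'
    simp only [T, Q, map_sub, map_add, map_mul, WittVector.map_verschiebung,
      WittVector.map_teichmuller]
    rw [hy', sub_self]
  · have h1 : T N - wlift (g k m) ∈ twoIdeal (MvPolynomial (Fin 5) k) := by
      rw [← Ideal.Quotient.eq, mk_wlift, g_eq]
      simp only [map_add, tau_mon, T]
      rfl
    have h2 : Q N - wlift (pairSum k m) ∈ twoIdeal (MvPolynomial (Fin 5) k) := by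
      have hp : pairSum k m = M 0 * M 1 + M 0 * M 2 + M 0 * M 3 + M 0 * N + M 1 * M 2 + M 1 * M 3 +
          M 1 * N + M 2 * M 3 + M 2 * N + M 3 * N := by
        simp only [M, N, Matrix.cons_val, mon_mul, pairSum, Nat.add_zero, Nat.zero_add,
          Nat.reduceAdd]
      have hM (i : Fin 4) : tau (M i) = Ideal.Quotient.mk _ (WittVector.teichmuller 2 (M i)) := by
        fin_cases i <;> exact tau_mon k _ _ _ _ _
      rw [← Ideal.Quotient.eq, mk_wlift, hp]
      simp only [map_add, map_mul, hM, Q]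
      rw [show tau N = _ from tau_mon k _ _ _ _ _]
    have h3 := verschiebung_two_mem h2
    rw [map_sub] at h3
    convert Ideal.sub_mem _ (Ideal.sub_mem _ h1 h3) (mem_twoIdeal.2 ⟨y, rfl⟩) using 1
    ring

end Monomials

/-! ### Δ(g) as a second elementary symmetric function -/

section Delta

/-- Pairs are sorted by whether they contain x. -/
theorem sum_powersetCard_two_insert {ι A : Type*} [DecidableEq ι] [CommRing A] (F : ι → A)
    {x : ι} {s : Finset ι} (hx : x ∉ s) :
    ∑ t ∈ (insert x s).powersetCard 2, ∏ i ∈ t, F i =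
      ∑ t ∈ s.powersetCard 2, ∏ i ∈ t, F i + F x * ∑ i ∈ s, F i := by
  rw [Finset.powersetCard_succ_insert hx, Finset.sum_union, Finset.sum_image]
  · congr 1
    rw [Finset.powersetCard_one, Finset.sum_map, Finset.mul_sum]
    refine Finset.sum_congr rfl fun i hi => ?_
    have : x ≠ i := fun h => hx (h ▸ hi)
    simp [this]
  · intro t ht t' ht' h
    have h1 : x ∉ t := fun h => hx ((Finset.mem_powersetCard.1 ht).1 h)
    have h2 : x ∉ t' := fun h => hx ((Finset.mem_powersetCard.1 ht').1 h)
    rw [← Finset.erase_insert h1, ← Finset.erase_insert h2, h]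
  · rw [Finset.disjoint_left]
    intro t ht ht'
    obtain ⟨t', -, rfl⟩ := Finset.mem_image.1 ht'
    exact hx ((Finset.mem_powersetCard.1 ht).1 (Finset.mem_insert_self x t'))

/-- In characteristic `2`, `Δ` is the second elementary symmetric function of the monomials. -/
theorem Delta_two {σ k : Type*} [CommRing k] (P : MvPolynomial σ k) :
    Delta 2 P = ∑ t ∈ P.support.powersetCard 2, ∏ d ∈ t, monomial d (P.coeff d) := by
  classical
  unfold Delta
  symm
  refine Finset.sum_bij (fun t _ d => if d ∈ t then 1 else 0) ?_ ?_ ?_ ?_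
  · intro t ht
    obtain ⟨ht, hc⟩ := Finset.mem_powersetCard.1 ht
    simp only [Finset.mem_filter, Finset.mem_piAntidiag]
    refine ⟨⟨?_, fun d hd => ht (by by_contra h; simp [h] at hd)⟩, fun d _ => by split_ifs <;> simp⟩
    rw [Finset.sum_ite_mem, Finset.inter_eq_right.2 ht]
    simp [hc]
  · intro t _ t' _ h
    ext d
    have := congrFun h d
    by_cases h1 : d ∈ t <;> by_cases h2 : d ∈ t' <;> simp_all
  · intro α hα
    simp only [Finset.mem_filter, Finset.mem_piAntidiag] at hα
    obtain ⟨⟨hs, hsupp⟩, h1⟩ := hα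
    have hle (d) : α d ≤ 1 := by
      by_cases hd : d ∈ P.support
      · exact h1 d hd
      · by_contra h
        exact hd (hsupp d (by omega))
    have hval : α = fun d => if d ∈ P.support.filter (fun d => α d = 1) then 1 else 0 := by
      funext d
      have := hle d
      split_ifs with h
      · exact (Finset.mem_filter.1 h).2
      · by_contra h0
        exact h (Finset.mem_filter.2 ⟨hsupp d h0, by omega⟩)
    refine ⟨P.support.filter (fun d => α d = 1), ?_, hval.symm⟩
    rw [Finset.mem_powersetCard]
    refine ⟨Finset.filter_subset _ _, ?_⟩
    rw [hval, Finset.sum_ite_mem, Finset.inter_eq_right.2 (Finset.filter_subset _ _)] at hs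
    simpa using hs
  · intro t ht
    obtain ⟨ht, hc⟩ := Finset.mem_powersetCard.1 ht
    -- The multinomial coefficient is 2!/(1!·1!) = 2, so after division by p = 2 every pair has
    -- coefficient 1.
    have hm : Nat.multinomial P.support (fun d => if d ∈ t then 1 else 0) = 2 := by
      rw [Nat.multinomial, Finset.sum_ite_mem, Finset.inter_eq_right.2 ht,
        Finset.prod_eq_one fun d _ => by split_ifs <;> rfl]
      simp [hc]
    rw [hm]
    simp only [Nat.div_self two_pos, Nat.cast_one, one_mul, pow_ite, pow_one, pow_zero]
    rw [Finset.prod_ite_mem, Finset.inter_eq_right.2 ht]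

theorem Delta_g (k : Type*) [Field k] (m : ℕ) : Delta 2 (g k m) = pairSum k m := by
  classical
  let T : Finset (Fin 5 →₀ ℕ) := {exps 4 0 0 0 0, exps 1 3 0 0 0, exps 0 1 3 0 0, exps 0 0 1 3 0,
    exps 0 0 0 0 m}
  have hgT : g k m = ∑ d ∈ T, monomial d 1 := by
    rw [g_eq]
    simp only [T]
    repeat rw [Finset.sum_insert (by simp [exps_inj])]
    rw [Finset.sum_singleton]
    simp only [mon]
    ring
  have hc (d) : (g k m).coeff d = if d ∈ T then 1 else 0 := by
    rw [hgT, coeff_sum]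
    simp only [coeff_monomial, Finset.sum_ite_eq']
  have hs : (g k m).support = T := by
    ext d
    rw [mem_support_iff, hc]
    simp
  have hF : ∀ t ∈ T.powersetCard 2, ∏ d ∈ t, monomial d ((g k m).coeff d) =
      ∏ d ∈ t, (monomial d 1 : MvPolynomial (Fin 5) k) := by
    intro t ht
    refine Finset.prod_congr rfl fun d hd => ?_
    rw [hc, if_pos ((Finset.mem_powersetCard.1 ht).1 hd)]
  rw [Delta_two, hs, Finset.sum_congr rfl hF]
  simp only [T]
  repeat rw [sum_powersetCard_two_insert _ (by simp [exps_inj])]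
  rw [Finset.powersetCard_eq_empty.2 (by simp), Finset.sum_empty]
  repeat rw [Finset.sum_insert (by simp [exps_inj])]
  rw [Finset.sum_singleton]
  change 0 + mon k 0 0 1 3 0 * mon k 0 0 0 0 m + mon k 0 1 3 0 0 * _ + mon k 1 3 0 0 0 * _ +
    mon k 4 0 0 0 0 * _ = _
  simp only [← mon.eq_def, mul_add, mon_mul, pairSum, Nat.add_zero, Nat.zero_add, Nat.reduceAdd]
  ring

end Delta

/-! ### The explicit chains, and the obstruction in length 9 -/

section Hypersurface

variable (k : Type*) [Field k] [CharP k 2] [PerfectRing k 2]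

theorem theta_eq (m : ℕ) (P : MvPolynomial (Fin 5) k) : theta (g k m) P = u 2 (pairSum k m * P) := by
  rw [theta, Delta_g]

theorem theta_add (G P Q : MvPolynomial (Fin 5) k) : theta G (P + Q) = theta G P + theta G Q := by
  rw [theta, theta, theta, mul_add, u_add]

theorem theta_mon (m a b c d e : ℕ) : theta (g k m) (mon k a b c d e) =
    u 2 (mon k (5 + a) (3 + b) c d e) + u 2 (mon k (4 + a) (1 + b) (3 + c) d e) +
    u 2 (mon k (4 + a) b (1 + c) (3 + d) e) + u 2 (mon k (4 + a) b c d (m + e)) +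
    u 2 (mon k (1 + a) (4 + b) (3 + c) d e) + u 2 (mon k (1 + a) (3 + b) (1 + c) (3 + d) e) +
    u 2 (mon k (1 + a) (3 + b) c d (m + e)) + u 2 (mon k a (1 + b) (4 + c) (3 + d) e) +
    u 2 (mon k a (1 + b) (3 + c) d (m + e)) + u 2 (mon k a b (1 + c) (3 + d) (m + e)) := by
  rw [theta_eq, pairSum]
  simp only [add_mul, u_add, mon_mul, Nat.zero_add]

theorem chain_one (m : ℕ) : chain k m 1 =
    mon k 6 1 2 3 (1023 - 2 * m) + mon k 3 4 2 3 (1023 - 2 * m) + mon k 2 2 5 3 (1023 - 2 * m) +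
      mon k 2 1 3 6 (1023 - 2 * m) + mon k 2 1 2 3 (1023 - 2 * m + m) := by
  have : chain k m 1 = mon k 2 1 2 3 (1023 - 2 * m) * g k m := by
    rw [chain, mon_eq, pow_one]
  rw [this, g_eq]
  simp only [mul_add, mon_mul, Nat.add_zero, Nat.reduceAdd]

theorem chain_succ_succ (m n : ℕ) :
    chain k m (n + 2) = theta (g k m) (chain k m (n + 1)) := by
  rw [chain]

theorem u_chain_one (m : ℕ) : u 2 (chain k m 1) = 0 := by
  rw [chain_one]
  simp (disch := omega) only [u_add, u_mon_even, add_zero]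

-- By linearity, u(x_i² c) = x_i u(c) has no constant term. This separates a_10, whose image under u
-- is 1, from the Frobenius power.
variable {k} in
theorem constantCoeff_u_of_mem_frobPow {P : MvPolynomial (Fin 5) k} (hP : P ∈ frobPow (Fin 5) k 2) :
    constantCoeff (u 2 P) = 0 := by
  induction hP using Submodule.span_induction with
  | mem x hx =>
    obtain ⟨i, rfl⟩ := hx
    have := u_sq_mul (X i) (1 : MvPolynomial (Fin 5) k)
    rw [mul_one] at this
    simp [this]
  | zero => rw [u_zero, map_zero]
  | add x y hx hy ihx ihy => rw [u_add, map_add, ihx, ihy, add_zero]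
  | smul a x hx ihx =>
    -- Knowing u(x) says nothing about u(ax), so a second induction on x runs with a arbitrary.
    clear ihx
    induction hx using Submodule.span_induction generalizing a with
    | mem x hx =>
      obtain ⟨i, rfl⟩ := hx
      rw [smul_eq_mul, mul_comm, u_sq_mul]
      simp
    | zero => rw [smul_zero, u_zero, map_zero]
    | add x y hx hy ihx ihy => rw [smul_add, u_add, map_add, ihx, ihy, add_zero]
    | smul b x hx ihx => rw [smul_smul, ihx]

set_option maxHeartbeats 1000000 in
theorem chain_odd (m : ℕ) (h : Odd m) (hm : m ≤ 511) :
    ChainOdd k m ∧ (∀ n, 1 ≤ n → n ≤ 9 → u 2 (chain k m n) = 0) ∧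
      u 2 (chain k m 10) = 1 := by
  rw [Nat.odd_iff] at h
  have h2 : chain k m 2 = mon k 3 2 2 1 (511 - m) := by
    rw [chain_succ_succ, chain_one]
    simp (disch := omega) only [theta_add, theta_mon, u_mon_odd, u_mon_even, Nat.reduceAdd,
      Nat.reduceDiv, add_zero, zero_add]
    -- A product of three distinct monomials of g occurs three times in gΔ(g), and 3 = 1 in
    -- characteristic 2.
    rw [CharTwo.add_self_eq_zero, zero_add, show (1023 - 2 * m) / 2 = 511 - m by omega]
  have h3 : chain k m 3 = mon k 1 1 2 0 255 := by
    rw [chain_succ_succ, h2]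
    simp (disch := omega) only [theta_mon, u_mon_odd, u_mon_even, Nat.reduceAdd,
      Nat.reduceDiv, add_zero, zero_add]
    exact mon_congr k (by omega)
  have h4 : chain k m 4 = mon k 2 0 1 1 127 := by
    rw [chain_succ_succ, h3]
    simp (disch := omega) only [theta_mon, u_mon_odd, u_mon_even, Nat.reduceAdd,
      Nat.reduceDiv, add_zero, zero_add]
  have h5 : chain k m 5 = mon k 3 1 0 0 63 := by
    rw [chain_succ_succ, h4]
    simp (disch := omega) only [theta_mon, u_mon_odd, u_mon_even, Nat.reduceAdd,
      Nat.reduceDiv, add_zero]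
  have h6 : chain k m 6 = mon k 3 0 0 1 31 := by
    rw [chain_succ_succ, h5]
    simp (disch := omega) only [theta_mon, u_mon_odd, u_mon_even, Nat.reduceAdd,
      Nat.reduceDiv, add_zero, zero_add]
  have h7 : chain k m 7 = mon k 3 0 1 0 15 := by
    rw [chain_succ_succ, h6]
    simp (disch := omega) only [theta_mon, u_mon_odd, u_mon_even, Nat.reduceAdd,
      Nat.reduceDiv, add_zero, zero_add]
  have h8 : chain k m 8 = mon k 1 0 2 1 7 := by
    rw [chain_succ_succ, h7]
    simp (disch := omega) only [theta_mon, u_mon_odd, u_mon_even, Nat.reduceAdd,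
      Nat.reduceDiv, add_zero, zero_add]
  have h9 : chain k m 9 = mon k 2 0 2 0 3 := by
    rw [chain_succ_succ, h8]
    simp (disch := omega) only [theta_mon, u_mon_odd, u_mon_even, Nat.reduceAdd,
      Nat.reduceDiv, add_zero, zero_add]
  have h10 : chain k m 10 = mon k 1 1 1 1 1 := by
    rw [chain_succ_succ, h9]
    simp (disch := omega) only [theta_mon, u_mon_odd, u_mon_even, Nat.reduceAdd,
      Nat.reduceDiv, add_zero, zero_add]
  refine ⟨?_, fun n hn hn' => ?_, ?_⟩
  · simp only [ChainOdd, h2, h3, h4, h5, h6, h7, h8, h9, h10, mon_eq]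
    refine ⟨?_, ?_, ?_, ?_, ?_, ?_, ?_, ?_, ?_⟩ <;> ring
  · interval_cases n
    · exact u_chain_one k _
    all_goals simp (disch := omega) only [h2, h3, h4, h5, h6, h7, h8, h9, u_mon_even]
  · rw [h10]
    simp (disch := omega) only [u_mon_odd, Nat.reduceDiv]
    simp [mon_eq]

-- For even m, multiplying by t^m keeps the parity of the t-exponent, so products with t^m survive u
-- next to those without. For odd r the second term of a_2 has even t-exponent and contributes
-- nothing to a_3; for m = 4s it does contribute.
set_option maxHeartbeats 1000000 in
theorem chain_two_mod_four (r : ℕ) (h : Odd r) (hm : 2 * r ≤ 511) :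
    ChainTwoModFour k (2 * r) r ∧ (∀ n, 1 ≤ n → n ≤ 9 → u 2 (chain k (2 * r) n) = 0) ∧
      u 2 (chain k (2 * r) 10) = 1 := by
  rw [Nat.odd_iff] at h
  have h0 : (2 : MvPolynomial (Fin 5) k) = 0 := CharTwo.two_eq_zero
  have h2 : chain k (2 * r) 2 = mon k 3 2 2 1 (511 - 2 * r) + mon k 1 2 2 1 (511 - r) := by
    rw [chain_succ_succ, chain_one]
    simp (disch := omega) only [theta_add, theta_mon, u_mon_odd, u_mon_even, Nat.reduceAdd,
      Nat.reduceDiv, add_zero, zero_add]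
    rw [show (1023 - 2 * (2 * r)) / 2 = 511 - 2 * r by omega,
      show (2 * r + (1023 - 2 * (2 * r))) / 2 = 511 - r by omega,
      show (1023 - 2 * (2 * r) + 2 * r) / 2 = 511 - r by omega]
    linear_combination (mon k 3 2 2 1 (511 - 2 * r) + mon k 1 2 2 1 (511 - r)) * h0
  have h3 : chain k (2 * r) 3 = mon k 3 1 2 0 (255 - r) + mon k 1 1 2 0 255 := by
    rw [chain_succ_succ, h2]
    simp (disch := omega) only [theta_add, theta_mon, u_mon_odd, u_mon_even, Nat.reduceAdd,
      Nat.reduceDiv, add_zero, zero_add]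
    exact congrArg₂ (· + ·) (mon_congr k (by omega)) (mon_congr k (by omega))
  have h4 : chain k (2 * r) 4 = mon k 2 0 1 1 127 + mon k 0 0 1 1 (127 + r) := by
    rw [chain_succ_succ, h3]
    simp (disch := omega) only [theta_add, theta_mon, u_mon_odd, u_mon_even, Nat.reduceAdd,
      Nat.reduceDiv, add_zero, zero_add]
    exact congrArg₂ (· + ·) (mon_congr k (by omega)) (mon_congr k (by omega))
  have h5 : chain k (2 * r) 5 = mon k 3 1 0 0 63 + mon k 1 1 0 0 (63 + r) := by
    rw [chain_succ_succ, h4]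
    simp (disch := omega) only [theta_add, theta_mon, u_mon_odd, u_mon_even, Nat.reduceAdd,
      Nat.reduceDiv, add_zero]
    exact congrArg₂ (· + ·) (mon_congr k (by omega)) (mon_congr k (by omega))
  have h6 : chain k (2 * r) 6 = mon k 3 0 0 1 31 + mon k 1 0 0 1 (31 + r) := by
    rw [chain_succ_succ, h5]
    simp (disch := omega) only [theta_add, theta_mon, u_mon_odd, u_mon_even, Nat.reduceAdd,
      Nat.reduceDiv, add_zero, zero_add]
    exact congrArg₂ (· + ·) (mon_congr k (by omega)) (mon_congr k (by omega))
  have h7 : chain k (2 * r) 7 = mon k 3 0 1 0 15 + mon k 1 0 1 0 (15 + r) := by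
    rw [chain_succ_succ, h6]
    simp (disch := omega) only [theta_add, theta_mon, u_mon_odd, u_mon_even, Nat.reduceAdd,
      Nat.reduceDiv, add_zero, zero_add]
    exact congrArg₂ (· + ·) (mon_congr k (by omega)) (mon_congr k (by omega))
  have h8 : chain k (2 * r) 8 = mon k 1 0 2 1 7 := by
    rw [chain_succ_succ, h7]
    simp (disch := omega) only [theta_add, theta_mon, u_mon_odd, u_mon_even, Nat.reduceAdd,
      Nat.reduceDiv, add_zero, zero_add]
  have h9 : chain k (2 * r) 9 = mon k 2 0 2 0 3 + mon k 0 0 2 0 (3 + r) := by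
    rw [chain_succ_succ, h8]
    simp (disch := omega) only [theta_mon, u_mon_odd, u_mon_even, Nat.reduceAdd,
      Nat.reduceDiv, add_zero, zero_add]
    exact congrArg₂ (· + ·) (mon_congr k (by omega)) (mon_congr k (by omega))
  have h10 : chain k (2 * r) 10 = mon k 1 1 1 1 1 := by
    rw [chain_succ_succ, h9]
    simp (disch := omega) only [theta_add, theta_mon, u_mon_odd, u_mon_even, Nat.reduceAdd,
      Nat.reduceDiv, add_zero, zero_add]
  refine ⟨?_, fun n hn hn' => ?_, ?_⟩
  · simp only [ChainTwoModFour, h2, h3, h4, h5, h6, h7, h8, h9, h10, mon_eq]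
    refine ⟨?_, ?_, ?_, ?_, ?_, ?_, ?_, ?_, ?_⟩ <;> ring
  · interval_cases n
    · exact u_chain_one k _
    all_goals simp (disch := omega) only [u_add, h2, h3, h4, h5, h6, h7, h8, h9, u_mon_even,
      add_zero]
  · rw [h10]
    simp (disch := omega) only [u_mon_odd, Nat.reduceDiv]
    simp [mon_eq]

-- The parity of s plays no role: when a t-exponent involves an odd multiple of s, the parities of
-- the other four exponents already force u to kill the products with Δ(g).
set_option maxHeartbeats 1000000 in
theorem chain_zero_mod_four (s : ℕ) (hm : 4 * s ≤ 511) :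
    ChainZeroModFour k (4 * s) s ∧ (∀ n, 1 ≤ n → n ≤ 9 → u 2 (chain k (4 * s) n) = 0) ∧
      u 2 (chain k (4 * s) 10) = 1 := by
  have h0 : (2 : MvPolynomial (Fin 5) k) = 0 := CharTwo.two_eq_zero
  have h2 : chain k (4 * s) 2 = mon k 3 2 2 1 (511 - 4 * s) + mon k 1 2 2 1 (511 - 2 * s) := by
    rw [chain_succ_succ, chain_one]
    simp (disch := omega) only [theta_add, theta_mon, u_mon_odd, u_mon_even, Nat.reduceAdd,
      Nat.reduceDiv, add_zero, zero_add]
    rw [show (1023 - 2 * (4 * s)) / 2 = 511 - 4 * s by omega,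
      show (4 * s + (1023 - 2 * (4 * s))) / 2 = 511 - 2 * s by omega,
      show (1023 - 2 * (4 * s) + 4 * s) / 2 = 511 - 2 * s by omega]
    linear_combination (mon k 3 2 2 1 (511 - 4 * s) + mon k 1 2 2 1 (511 - 2 * s)) * h0
  have h3 : chain k (4 * s) 3 = mon k 3 1 2 0 (255 - 2 * s) + mon k 1 1 2 0 255 +
      (mon k 2 1 2 0 (255 - s) + mon k 0 1 2 0 (255 + s)) := by
    rw [chain_succ_succ, h2]
    simp (disch := omega) only [theta_add, theta_mon, u_mon_odd, u_mon_even, Nat.reduceAdd,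
      Nat.reduceDiv, add_zero, zero_add]
    exact congrArg₂ (· + ·) (congrArg₂ (· + ·) (mon_congr k (by omega)) (mon_congr k (by omega)))
      (congrArg₂ (· + ·) (mon_congr k (by omega)) (mon_congr k (by omega)))
  have h4 : chain k (4 * s) 4 = mon k 3 0 1 1 (127 - s) + mon k 1 0 1 1 (127 + s) +
      (mon k 2 0 1 1 127 + mon k 0 0 1 1 (127 + 2 * s)) := by
    rw [chain_succ_succ, h3]
    simp (disch := omega) only [theta_add, theta_mon, u_mon_odd, u_mon_even, Nat.reduceAdd,
      Nat.reduceDiv, add_zero, zero_add]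
    exact congrArg₂ (· + ·) (congrArg₂ (· + ·) (mon_congr k (by omega)) (mon_congr k (by omega)))
      (congrArg₂ (· + ·) (mon_congr k (by omega)) (mon_congr k (by omega)))
  have h5 : chain k (4 * s) 5 = mon k 3 1 0 0 63 + mon k 1 1 0 0 (63 + 2 * s) +
      (mon k 2 1 0 0 (63 + s) + mon k 0 1 0 0 (63 + 3 * s)) := by
    rw [chain_succ_succ, h4]
    simp (disch := omega) only [theta_add, theta_mon, u_mon_odd, u_mon_even, Nat.reduceAdd,
      Nat.reduceDiv, add_zero, zero_add]
    exact congrArg₂ (· + ·) (congrArg₂ (· + ·) (mon_congr k (by omega)) (mon_congr k (by omega)))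
      (congrArg₂ (· + ·) (mon_congr k (by omega)) (mon_congr k (by omega)))
  have h6 : chain k (4 * s) 6 = mon k 3 0 0 1 31 + mon k 1 0 0 1 (31 + 2 * s) +
      (mon k 2 0 0 1 (31 + s) + mon k 0 0 0 1 (31 + 3 * s)) := by
    rw [chain_succ_succ, h5]
    simp (disch := omega) only [theta_add, theta_mon, u_mon_odd, u_mon_even, Nat.reduceAdd,
      Nat.reduceDiv, add_zero, zero_add]
    exact congrArg₂ (· + ·) (congrArg₂ (· + ·) (mon_congr k (by omega)) (mon_congr k (by omega)))
      (congrArg₂ (· + ·) (mon_congr k (by omega)) (mon_congr k (by omega)))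
  have h7 : chain k (4 * s) 7 = mon k 3 0 1 0 15 + mon k 1 0 1 0 (15 + 2 * s) +
      (mon k 2 0 1 0 (15 + s) + mon k 0 0 1 0 (15 + 3 * s)) := by
    rw [chain_succ_succ, h6]
    simp (disch := omega) only [theta_add, theta_mon, u_mon_odd, u_mon_even, Nat.reduceAdd,
      Nat.reduceDiv, add_zero, zero_add]
    exact congrArg₂ (· + ·) (congrArg₂ (· + ·) (mon_congr k (by omega)) (mon_congr k (by omega)))
      (congrArg₂ (· + ·) (mon_congr k (by omega)) (mon_congr k (by omega)))
  have h8 : chain k (4 * s) 8 = mon k 1 0 2 1 7 + mon k 0 0 2 1 (7 + s) := by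
    rw [chain_succ_succ, h7]
    simp (disch := omega) only [theta_add, theta_mon, u_mon_odd, u_mon_even, Nat.reduceAdd,
      Nat.reduceDiv, add_zero, zero_add]
    exact congrArg₂ (· + ·) (mon_congr k (by omega)) (mon_congr k (by omega))
  have h9 : chain k (4 * s) 9 = mon k 2 0 2 0 3 + mon k 0 0 2 0 (3 + 2 * s) := by
    rw [chain_succ_succ, h8]
    simp (disch := omega) only [theta_add, theta_mon, u_mon_odd, u_mon_even, Nat.reduceAdd,
      Nat.reduceDiv, add_zero, zero_add]
    exact congrArg₂ (· + ·) (mon_congr k (by omega)) (mon_congr k (by omega))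
  have h10 : chain k (4 * s) 10 = mon k 1 1 1 1 1 + mon k 0 1 1 1 (1 + s) := by
    rw [chain_succ_succ, h9]
    simp (disch := omega) only [theta_add, theta_mon, u_mon_odd, u_mon_even, Nat.reduceAdd,
      Nat.reduceDiv, add_zero, zero_add]
    exact congrArg₂ (· + ·) (mon_congr k (by omega)) (mon_congr k (by omega))
  refine ⟨?_, fun n hn hn' => ?_, ?_⟩
  · simp only [ChainZeroModFour, h2, h3, h4, h5, h6, h7, h8, h9, h10, mon_eq]
    refine ⟨?_, ?_, ?_, ?_, ?_, ?_, ?_, ?_, ?_⟩ <;> ring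
  · interval_cases n
    · exact u_chain_one k _
    all_goals simp (disch := omega) only [u_add, h2, h3, h4, h5, h6, h7, h8, h9, u_mon_even,
      add_zero]
  · rw [h10]
    simp (disch := omega) only [u_add, u_mon_odd, u_mon_even, Nat.reduceDiv, add_zero]
    simp [mon_eq]

theorem not_isQuasiFSplit_nine {m : ℕ} (hm : 256 ≤ m) : ¬ IsQuasiFSplit 2 9 (HypRing k m) := by
  intro hsplit
  -- The five conditions say that no monomial of g divides the given one, so multiples of g do not
  -- involve it.
  have hcg (P : MvPolynomial (Fin 5) k) (a b c d e : ℕ) (h1 : a < 4) (h2 : a < 1 ∨ b < 3)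
      (h3 : b < 1 ∨ c < 3) (h4 : c < 1 ∨ d < 3) (h5 : e < m) :
      (g k m * P).coeff (exps a b c d e) = 0 := by
    rw [g_eq]
    simp only [add_mul, coeff_add, coeff_mon_mul]
    rw [if_neg (by omega), if_neg (by omega), if_neg (by omega), if_neg (by omega),
      if_neg (by omega)]
    simp
  have hg0 : g k m ≠ 0 := by
    intro h0
    have := congrArg (eval ![1, 0, 0, 0, 0]) h0
    simp [g, f, show m ≠ 0 by omega] at this
  obtain ⟨b, c, hb0, hb, hlast⟩ := hsplit.exists_chain (wittRel_g k m) hg0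
  have hstep (j a₁ a₂ a₃ a₄ a₅ : ℕ) (h1 : a₁ < 4) (h2 : a₁ < 1 ∨ a₂ < 3) (h3 : a₂ < 1 ∨ a₃ < 3)
      (h4 : a₃ < 1 ∨ a₄ < 3) (h5 : a₅ < m)
      (h : (pairSum k m * b j).coeff
        (exps (2 * a₁ + 1) (2 * a₂ + 1) (2 * a₃ + 1) (2 * a₄ + 1) (2 * a₅ + 1)) = 0) :
      (b (j + 1)).coeff (exps a₁ a₂ a₃ a₄ a₅) = 0 := by
    rw [hb, coeff_add, hcg _ _ _ _ _ _ h1 h2 h3 h4 h5, coeff_u, two_smul_exps_add_ind, h, map_zero,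
      add_zero]
  have hm1 (n : ℕ) (hn : n < 256) : ¬ m ≤ n := by omega
  -- The bound m ≥ 256 gives 511 - m < m, so t^m does not divide these monomials of b_1 = g c_0.
  have b1 (a₁ a₂ a₃ a₄ : ℕ) (h1 : a₁ < 4) (h2 : a₁ < 1 ∨ a₂ < 3) (h3 : a₂ < 1 ∨ a₃ < 3)
      (h4 : a₃ < 1 ∨ a₄ < 3) : (b 1).coeff (exps a₁ a₂ a₃ a₄ (511 - m)) = 0 :=
    hstep 0 _ _ _ _ _ h1 h2 h3 h4 (by omega) (by rw [hb0, mul_zero, coeff_zero])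
  have b2 : (b 2).coeff (exps 1 0 0 3 255) = 0 := by
    apply hstep <;> try omega
    simp [pairSum, add_mul, coeff_mon_mul, b1]
  have b2' : (b 2).coeff (exps 1 1 2 0 255) = 0 := by
    apply hstep <;> try omega
    simp [pairSum, add_mul, coeff_mon_mul, b1]
  -- This is the one place where the backward path branches: the target (5,1,3,3,255) is reached
  -- from two monomials of b_2. Pairs with t^m are excluded since 255 < m.
  have b3 : (b 3).coeff (exps 2 0 1 1 127) = 0 := by
    apply hstep <;> try omega
    simp [pairSum, add_mul, coeff_mon_mul, b2, b2', hm1]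
  have b4 : (b 4).coeff (exps 3 1 0 0 63) = 0 := by
    apply hstep <;> try omega
    simp [pairSum, add_mul, coeff_mon_mul, b3, hm1]
  have b5 : (b 5).coeff (exps 3 0 0 1 31) = 0 := by
    apply hstep <;> try omega
    simp [pairSum, add_mul, coeff_mon_mul, b4, hm1]
  have b6 : (b 6).coeff (exps 3 0 1 0 15) = 0 := by
    apply hstep <;> try omega
    simp [pairSum, add_mul, coeff_mon_mul, b5, hm1]
  have b7 : (b 7).coeff (exps 1 0 2 1 7) = 0 := by
    apply hstep <;> try omega
    simp [pairSum, add_mul, coeff_mon_mul, b6, hm1]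
  have b8 : (b 8).coeff (exps 2 0 2 0 3) = 0 := by
    apply hstep <;> try omega
    simp [pairSum, add_mul, coeff_mon_mul, b7, hm1]
  have b9 : (b 9).coeff (exps 1 1 1 1 1) = 0 := by
    apply hstep <;> try omega
    simp [pairSum, add_mul, coeff_mon_mul, b8, hm1]
  obtain ⟨q, hq⟩ := Ideal.mem_span_singleton.1 hlast
  -- The constant term of u(b_9) is the root of the coefficient of xyzwt in b_9, hence 0; but u(b_9)
  -- - 1 is a multiple of g and has no constant term.
  have h0 := hcg q 0 0 0 0 0 (by omega) (by omega) (by omega) (by omega) (by omega)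
  rw [← hq, coeff_sub, coeff_u, two_smul_exps_add_ind, b9, map_zero, zero_sub, neg_eq_zero,
    coeff_one, if_pos] at h0
  · exact one_ne_zero h0
  · rw [DFunLike.ext_iff, forall_fin_five]
    exact ⟨rfl, rfl, rfl, rfl, rfl⟩

end Hypersurface

end QFS

theorem mainTheorem5 (k : Type*) [Field k] [CharP k 2] [PerfectRing k 2] :
    (∀ m : ℕ, 1 ≤ m → m ≤ 511 →
      QFS.IsQuasiFSplit 2 10 (QFS.HypRing k m) ∧
      (∀ n : ℕ, 1 ≤ n → n ≤ 9 → QFS.u 2 (QFS.chain k m n) = 0) ∧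
      QFS.chain k m 10 ∉ QFS.frobPow (Fin 5) k 2 ∧
      (Odd m → QFS.ChainOdd k m) ∧
      (∀ r : ℕ, Odd r → m = 2 * r → QFS.ChainTwoModFour k m r) ∧
      (∀ s : ℕ, m = 4 * s → QFS.ChainZeroModFour k m s)) ∧
    (∀ m : ℕ, 256 ≤ m → ¬ QFS.IsQuasiFSplit 2 9 (QFS.HypRing k m)) := by
  refine ⟨fun m h1 hm => ?_, fun m hm => QFS.not_isQuasiFSplit_nine k hm⟩
  have main : (∀ n, 1 ≤ n → n ≤ 9 → QFS.u 2 (QFS.chain k m n) = 0) ∧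
      QFS.u 2 (QFS.chain k m 10) = 1 := by
    -- The three shapes of the chain correspond to m odd, m ≡ 2 and m ≡ 0 modulo 4.
    rcases Nat.even_or_odd' m with ⟨r, rfl | rfl⟩
    · rcases Nat.even_or_odd' r with ⟨s, rfl | rfl⟩
      · rw [← mul_assoc] at hm ⊢
        exact (QFS.chain_zero_mod_four k s hm).2
      · exact (QFS.chain_two_mod_four k _ (odd_two_mul_add_one s) hm).2
    · exact (QFS.chain_odd k _ (odd_two_mul_add_one r) hm).2
  obtain ⟨hker, hlast⟩ := main
  refine ⟨?_, hker, fun h => ?_, fun h => (QFS.chain_odd k m h hm).1, ?_, ?_⟩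
  · refine QFS.isQuasiFSplit_of_chain (QFS.wittRel_g k m) 9 (QFS.chain k m) ?_ ?_ hker hlast
    · rw [QFS.chain]
      exact Ideal.mul_mem_left _ _ (Ideal.mem_span_singleton_self _)
    · intro j hj _
      obtain ⟨i, rfl⟩ := Nat.exists_eq_add_of_le' hj
      rw [QFS.chain_succ_succ, QFS.theta_eq]
  · have := QFS.constantCoeff_u_of_mem_frobPow h
    rw [hlast, map_one] at this
    exact one_ne_zero this
  · rintro r hr rfl
    exact (QFS.chain_two_mod_four k r hr hm).1
  · rintro s rfl
    exact (QFS.chain_zero_mod_four k s hm).1
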